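/- Let $k$ be a commutative ring and let $H$ be a quasitriangular quasi-Hopf algebra over $k$, with coproduct $\Delta(h)=h_{(1)}\otimes h_{(2)}$, counit $\epsilon$, associator $\phi=\phi^{(1)}\otimes\phi^{(2)}\otimes\phi^{(3)}\in H\otimes H\otimes H$ (inverse $\phi^{-1}=\phi^{(-1)}\otimes\phi^{(-2)}\otimes\phi^{(-3)}$), quasi-antipode $(S,\alpha,\beta)$ with $S$ bijective, and universal $R$-matrix $R=R^{(1)}\otimes R^{(2)}\in H\otimes H$. Let ${}^H\mathscr{M}$ be the category of left $H$-modules with its closed braided monoidal structure: $H$ acts on $V\otimes W=V\otimes_k W$ through $\Delta$; the associator is $\Phi\big((v\otimes w)\otimes x\big)=(\phi^{(1)}\triangleright v)\otimes\big((\phi^{(2)}\triangleright w)\otimes(\phi^{(3)}\triangleright x)\big)$; the braiding is $\tau_{V,W}(v\otimes w)=(R^{(2)}\triangleright w)\otimes(R^{(1)}\triangleright v)$; the internal hom is $\hom(V,W)=\mathrm{Hom}_k(V,W)$ with $h\triangleright L=(h_{(1)}\triangleright\,\cdot\,)\circ L\circ(S(h_{(2)})\triangleright\,\cdot\,)$,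 with currying bijection $$\zeta:\mathrm{Hom}(V\otimes W,X)\to\mathrm{Hom}(V,\hom(W,X)),\qquad \zeta(f)(v)=f\big((\phi^{(-1)}\triangleright v)\otimes(\phi^{(-2)}\beta S(\phi^{(-3)})\triangleright\,\cdot\,)\big),$$ evaluation $\mathrm{ev}=\zeta^{-1}(\mathrm{id})$ and composition $\bullet=\zeta\big(\mathrm{ev}\circ(\mathrm{id}\otimes\mathrm{ev})\circ\Phi\big)$. Let $A$ be a braided commutative algebra in ${}^H\mathscr{M}$, that is, a monoid object whose product satisfies $\mu\circ\tau_{A,A}=\mu$. Let ${}^H{}_A\mathscr{M}_A$ be the category of $A$-bimodules in ${}^H\mathscr{M}$, with left and right actions $l_V:A\otimes V\to V$ and $r_V:V\otimes A\to V$. It is monoidal under the tensor product $V\otimes_A W$, the coequalizer $\pi_{V,W}:V\otimes W\to V\otimes_A W$ of $r_V\otimes\mathrm{id}_W$ and $(\mathrm{id}_V\otimes l_W)\circ\Phi:(V\otimes A)\otimes W\to V\otimes W$, with unit object $A$. For $A$-bimodules $V,W$ the object $\hom(V,W)$ is an $A$-bimodule with left action $\bullet\circ(\zeta(l_W)\otimes\mathrm{id})$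 and right action $\bullet\circ(\mathrm{id}\otimes\zeta(l_V))$, and $\hom_A(V,W)\subseteq\hom(V,W)$ denotes the sub-bimodule that is the equalizer of $\zeta(\mathrm{ev}\circ(\mathrm{id}\otimes r_V))$ and $\zeta(r_W\circ(\mathrm{ev}\otimes\mathrm{id})\circ\Phi^{-1}):\hom(V,W)\to\hom(V\otimes A,W)$; it is functorial by $\hom_A(f,g)(L)=g\circ L\circ f$. An $A$-bimodule $V$ is called symmetric if $r_V\circ\tau_{A,V}=l_V$ and $l_V\circ\tau_{V,A}=r_V$; let ${}^H{}_A\mathscr{M}^{\mathrm{sym}}_A$ be the full subcategory of symmetric $A$-bimodules. **Theorem.** The unit object $A$ is symmetric, and if $V,W$ are symmetric $A$-bimodules then so are $V\otimes_A W$ and $\hom_A(V,W)$; hence ${}^H{}_A\mathscr{M}^{\mathrm{sym}}_A$ is a monoidal subcategory of ${}^H{}_A\mathscr{M}_A$ and $\hom_A$ restricts to it. The braiding $\tau$ descends to a braiding $\tau^A$ on the monoidal category ${}^H{}_A\mathscr{M}^{\mathrm{sym}}_A$: for all symmetric $V,W$ there is a well-defined morphism $\tau^A_{V,W}:V\otimes_A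 W\to W\otimes_A V$ with $\tau^A_{V,W}\circ\pi_{V,W}=\pi_{W,V}\circ\tau_{V,W}$, i.e. $$\tau^A_{V,W}(v\otimes_A w)=(R^{(2)}\triangleright w)\otimes_A(R^{(1)}\triangleright v),$$ and these morphisms are natural isomorphisms satisfying the hexagon identities. Moreover $\hom_A$ is an internal hom for ${}^H{}_A\mathscr{M}^{\mathrm{sym}}_A$: there are bijections $$\mathrm{Hom}(V\otimes_A W,X)\cong\mathrm{Hom}(V,\hom_A(W,X)),$$ natural in the symmetric $A$-bimodules $V,W,X$, under which $f$ corresponds to the corestriction of $\zeta(f\circ\pi_{V,W})$ to $\hom_A(W,X)$. Consequently ${}^H{}_A\mathscr{M}^{\mathrm{sym}}_A$ is a braided closed monoidal category. -/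

import Mathlib

open CategoryTheory MonoidalCategory Limits
open scoped TensorProduct

universe u v

set_option linter.unusedSimpArgs false
set_option linter.unusedSectionVars false

/-! ### Quasi-Hopf algebras -/

section QuasiHopf

variable {k : Type u} [CommRing k] {H : Type v} [Ring H] [Algebra k H]

/-- The linear map `x ⊗ y ↦ f x * a * g y`. -/
noncomputable def mulInsert {M N : Type*} [AddCommGroup M] [Module k M] [AddCommGroup N]
    [Module k N] (f : M →ₗ[k] H) (a : H) (g : N →ₗ[k] H) : M ⊗[k] N →ₗ[k] H :=
  LinearMap.mul' k H ∘ₗ TensorProduct.map (LinearMap.mulRight k a ∘ₗ f) g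

@[simp] theorem mulInsert_tmul {M N : Type*} [AddCommGroup M] [Module k M] [AddCommGroup N]
    [Module k N] (f : M →ₗ[k] H) (a : H) (g : N →ₗ[k] H) (x : M) (y : N) :
    mulInsert f a g (x ⊗ₜ[k] y) = f x * a * g y := rfl

/-- The algebra isomorphism `x ⊗ (y ⊗ z) ↦ x ⊗ (z ⊗ y)` of `H ⊗ (H ⊗ H)`. -/
noncomputable def swap23 : H ⊗[k] (H ⊗[k] H) ≃ₐ[k] H ⊗[k] (H ⊗[k] H) :=
  Algebra.TensorProduct.congr AlgEquiv.refl (Algebra.TensorProduct.comm k H H)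

/-- The algebra isomorphism `x ⊗ (y ⊗ z) ↦ y ⊗ (x ⊗ z)` of `H ⊗ (H ⊗ H)`. -/
noncomputable def swap12 : H ⊗[k] (H ⊗[k] H) ≃ₐ[k] H ⊗[k] (H ⊗[k] H) :=
  ((Algebra.TensorProduct.assoc k k k H H H).symm.trans
    (Algebra.TensorProduct.congr (Algebra.TensorProduct.comm k H H) AlgEquiv.refl)).trans
    (Algebra.TensorProduct.assoc k k k H H H)

@[simp] theorem swap23_tmul (x y z : H) :
    swap23 (k := k) (x ⊗ₜ[k] (y ⊗ₜ[k] z)) = x ⊗ₜ[k] (z ⊗ₜ[k] y) := rfl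

@[simp] theorem swap12_tmul (x y z : H) :
    swap12 (k := k) (x ⊗ₜ[k] (y ⊗ₜ[k] z)) = y ⊗ₜ[k] (x ⊗ₜ[k] z) := rfl

end QuasiHopf

/-- A quasi-Hopf algebra structure on a `k`-algebra `H`: the coproduct `Δ = comul`, the counit
`ε = counit`, the associator `φ ∈ H ⊗ H ⊗ H` and the quasi-antipode `(S, α, β)`. -/
class QuasiHopfAlgebra (k : Type u) [CommRing k] (H : Type v) [Ring H] [Algebra k H] where
  comul : H →ₐ[k] H ⊗[k] H
  counit : H →ₐ[k] k
  φ : (H ⊗[k] (H ⊗[k] H))ˣ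
  /-- `(ε ⊗ id) Δ(h) = h` -/
  counit_comul (h : H) : Algebra.TensorProduct.lid k H
    (Algebra.TensorProduct.map counit (AlgHom.id k H) (comul h)) = h
  /-- `(id ⊗ ε) Δ(h) = h` -/
  comul_counit (h : H) : Algebra.TensorProduct.rid k k H
    (Algebra.TensorProduct.map (AlgHom.id k H) counit (comul h)) = h
  /-- `(id ⊗ Δ) Δ(h) · φ = φ · (Δ ⊗ id) Δ(h)` -/
  quasi_coassoc (h : H) :
    Algebra.TensorProduct.map (AlgHom.id k H) comul (comul h) * φ.val =
      φ.val * Algebra.TensorProduct.assoc k k k H H H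
        (Algebra.TensorProduct.map comul (AlgHom.id k H) (comul h))
  /-- `(id ⊗ id ⊗ Δ)(φ) · (Δ ⊗ id ⊗ id)(φ) = (1 ⊗ φ) · (id ⊗ Δ ⊗ id)(φ) · (φ ⊗ 1)` -/
  cocycle :
    Algebra.TensorProduct.map (AlgHom.id k H)
        (Algebra.TensorProduct.map (AlgHom.id k H) comul) φ.val *
      Algebra.TensorProduct.assoc k k k H H (H ⊗[k] H)
        (Algebra.TensorProduct.map comul (AlgHom.id k (H ⊗[k] H)) φ.val) =
    ((1 : H) ⊗ₜ[k] φ.val) *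
      Algebra.TensorProduct.map (AlgHom.id k H)
        ((Algebra.TensorProduct.assoc k k k H H H).toAlgHom.comp
          (Algebra.TensorProduct.map comul (AlgHom.id k H))) φ.val *
      Algebra.TensorProduct.map (AlgHom.id k H)
        (Algebra.TensorProduct.assoc k k k H H H).toAlgHom
        (Algebra.TensorProduct.assoc k k k H (H ⊗[k] H) H (φ.val ⊗ₜ[k] (1 : H)))
  /-- `(id ⊗ ε ⊗ id)(φ) = 1 ⊗ 1` -/
  counit_φ :
    Algebra.TensorProduct.map (AlgHom.id k H)
      ((Algebra.TensorProduct.lid k H).toAlgHom.comp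
        (Algebra.TensorProduct.map counit (AlgHom.id k H))) φ.val = 1
  /-- The algebra anti-automorphism `S`. -/
  antipode : H ≃ₗ[k] H
  antipode_anti (x y : H) : antipode (x * y) = antipode y * antipode x
  α : H
  β : H
  /-- `S(h₁) α h₂ = ε(h) α` -/
  antipode_mul (h : H) :
    mulInsert antipode.toLinearMap α
      LinearMap.id (comul h) = counit h • α
  /-- `h₁ β S(h₂) = ε(h) β` -/
  mul_antipode (h : H) :
    mulInsert LinearMap.id β
      antipode.toLinearMap
      (comul h) = counit h • β
  /-- `φ⁽¹⁾ β S(φ⁽²⁾) α φ⁽³⁾ = 1` -/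
  antipode_φ :
    mulInsert LinearMap.id β
      (mulInsert antipode.toLinearMap α
        LinearMap.id) φ.val = 1
  /-- `S(φ⁽⁻¹⁾) α φ⁽⁻²⁾ β S(φ⁽⁻³⁾) = 1` -/
  antipode_φ_inv :
    mulInsert antipode.toLinearMap α
      (mulInsert LinearMap.id β
        antipode.toLinearMap)
      (φ⁻¹).val = 1

/-- A quasitriangular quasi-Hopf algebra: a quasi-Hopf algebra with a universal `R`-matrix.
For `X ∈ H ⊗ H ⊗ H` the element `X_{i₁i₂i₃}` has the `j`-th tensor factor of `X` in the
place `i_j`. -/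
class QuasitriangularQuasiHopfAlgebra (k : Type u) [CommRing k] (H : Type v) [Ring H]
    [Algebra k H] extends QuasiHopfAlgebra k H where
  R : (H ⊗[k] H)ˣ
  /-- `Δᵒᵖ(h) = R Δ(h) R⁻¹` -/
  comul_op (h : H) :
    Algebra.TensorProduct.comm k H H (comul h) = R.val * comul h * (R⁻¹).val
  /-- `(id ⊗ Δ)(R) = φ₂₃₁⁻¹ R₁₃ φ₂₁₃ R₁₂ φ₁₂₃⁻¹` -/
  id_comul_R :
    Algebra.TensorProduct.map (AlgHom.id k H) comul R.val =
      swap12 (swap23 (φ⁻¹).val) *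
      Algebra.TensorProduct.map (AlgHom.id k H) Algebra.TensorProduct.includeRight R.val *
      swap12 φ.val *
      Algebra.TensorProduct.assoc k k k H H H (R.val ⊗ₜ[k] (1 : H)) *
      (φ⁻¹).val
  /-- `(Δ ⊗ id)(R) = φ₃₁₂ R₁₃ φ₁₃₂⁻¹ R₂₃ φ₁₂₃` -/
  comul_id_R :
    Algebra.TensorProduct.assoc k k k H H H
        (Algebra.TensorProduct.map comul (AlgHom.id k H) R.val) =
      swap23 (swap12 φ.val) *
      Algebra.TensorProduct.map (AlgHom.id k H) Algebra.TensorProduct.includeRight R.val *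
      swap23 (φ⁻¹).val *
      ((1 : H) ⊗ₜ[k] R.val) *
      φ.val

/-! ### Left modules -/

/-- A left `H`-module: a `k`-module together with a `k`-linear left action of `H`. -/
structure HModule (k : Type u) [CommRing k] (H : Type v) [Ring H] [Algebra k H] where
  carrier : Type u
  [addCommGroup : AddCommGroup carrier]
  [module : Module k carrier]
  act : H →ₐ[k] Module.End k carrier

namespace HModule

section Basic

variable {k : Type u} [CommRing k] {H : Type v} [Ring H] [Algebra k H]

instance : CoeSort (HModule k H) (Type u) := ⟨carrier⟩

attribute [instance] addCommGroup module

/-- `H`-equivariant `k`-linear maps. -/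
@[ext]
structure Hom (V W : HModule k H) where
  lin : V →ₗ[k] W
  equivariant (h : H) : lin ∘ₗ V.act h = W.act h ∘ₗ lin

@[simps]
instance : Category (HModule k H) where
  Hom := Hom
  id V := ⟨LinearMap.id, fun _ => rfl⟩
  comp f g := ⟨g.lin ∘ₗ f.lin, fun h => by
    rw [LinearMap.comp_assoc, f.equivariant, ← LinearMap.comp_assoc, g.equivariant,
      LinearMap.comp_assoc]⟩

/-- The linear map underlying a morphism. -/
abbrev lin {V W : HModule k H} (f : V ⟶ W) : V →ₗ[k] W := Hom.lin f

@[simp] theorem lin_id (V : HModule k H) : lin (𝟙 V) = LinearMap.id := rfl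

@[simp] theorem lin_comp {V W X : HModule k H} (f : V ⟶ W) (g : W ⟶ X) :
    lin (f ≫ g) = lin g ∘ₗ lin f := rfl

@[ext] theorem hom_ext {V W : HModule k H} {f g : V ⟶ W} (h : lin f = lin g) : f = g :=
  Hom.ext h

theorem lin_act {V W : HModule k H} (f : V ⟶ W) (h : H) (v : V) :
    lin f (V.act h v) = W.act h (lin f v) :=
  LinearMap.congr_fun (f.equivariant h) v

/-- An equivariant linear equivalence is an isomorphism. -/
@[simps]
def isoMk {V W : HModule k H} (e : V ≃ₗ[k] W)
    (he : ∀ h : H, e.toLinearMap ∘ₗ V.act h = W.act h ∘ₗ e.toLinearMap) : V ≅ W where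
  hom := ⟨e.toLinearMap, he⟩
  inv := ⟨e.symm.toLinearMap, fun h => by
    ext w
    apply e.injective
    have := LinearMap.congr_fun (he h) (e.symm w)
    simp at this
    simp [this]⟩
  hom_inv_id := by apply hom_ext; ext v; simp [lin]
  inv_hom_id := by apply hom_ext; ext v; simp [lin]

end Basic

end HModule

namespace HModule

section PairAct

variable {k : Type*} [CommRing k] {B C D B' C' : Type*} [Ring B] [Algebra k B] [Ring C] [Algebra k C]
  [Ring D] [Algebra k D] [Ring B'] [Algebra k B'] [Ring C'] [Algebra k C']
  {V W X V' W' : Type*} [AddCommGroup V] [Module k V] [AddCommGroup W] [Module k W]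
  [AddCommGroup X] [Module k X] [AddCommGroup V'] [Module k V'] [AddCommGroup W'] [Module k W']

/-- The action of `B ⊗ C` on `V ⊗ W` given by actions of `B` on `V` and of `C` on `W`. -/
noncomputable def pairAct (f : B →ₐ[k] Module.End k V) (g : C →ₐ[k] Module.End k W) :
    B ⊗[k] C →ₐ[k] Module.End k (V ⊗[k] W) :=
  Module.endTensorEndAlgHom.comp (Algebra.TensorProduct.map f g)

@[simp] theorem pairAct_tmul (f : B →ₐ[k] Module.End k V) (g : C →ₐ[k] Module.End k W)
    (x : B) (y : C) : pairAct f g (x ⊗ₜ[k] y) = TensorProduct.map (f x) (g y) := rfl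

theorem pairAct_map (f : B →ₐ[k] Module.End k V) (g : C →ₐ[k] Module.End k W)
    (a : B' →ₐ[k] B) (b : C' →ₐ[k] C) (z : B' ⊗[k] C') :
    pairAct f g (Algebra.TensorProduct.map a b z) = pairAct (f.comp a) (g.comp b) z := by
  induction z with
  | zero => simp
  | add x y hx hy => simp only [map_add, hx, hy]
  | tmul x y => rfl

theorem pairAct_map_left (f : B →ₐ[k] Module.End k V) (g : C →ₐ[k] Module.End k W)
    (a : B' →ₐ[k] B) (z : B' ⊗[k] C) :
    pairAct f g (Algebra.TensorProduct.map a (AlgHom.id k C) z) = pairAct (f.comp a) g z := by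
  rw [pairAct_map, AlgHom.comp_id]

theorem pairAct_map_right (f : B →ₐ[k] Module.End k V) (g : C →ₐ[k] Module.End k W)
    (b : C' →ₐ[k] C) (z : B ⊗[k] C') :
    pairAct f g (Algebra.TensorProduct.map (AlgHom.id k B) b z) = pairAct f (g.comp b) z := by
  rw [pairAct_map, AlgHom.comp_id]

theorem pairAct_assoc (f : B →ₐ[k] Module.End k V) (g : C →ₐ[k] Module.End k W)
    (h : D →ₐ[k] Module.End k X) (z : (B ⊗[k] C) ⊗[k] D) :
    (TensorProduct.assoc k V W X).toLinearMap ∘ₗ pairAct (pairAct f g) h z =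
      pairAct f (pairAct g h) (Algebra.TensorProduct.assoc k k k B C D z) ∘ₗ
        (TensorProduct.assoc k V W X).toLinearMap := by
  induction z with
  | zero => simp
  | add x y hx hy => simp only [map_add, LinearMap.comp_add, LinearMap.add_comp, hx, hy]
  | tmul x y =>
    induction x with
    | zero => simp
    | add x x' hx hy =>
      simp only [TensorProduct.add_tmul, map_add, LinearMap.comp_add, LinearMap.add_comp, hx, hy]
    | tmul x x' => ext; rfl

theorem pairAct_naturality {f : B →ₐ[k] Module.End k V} {g : C →ₐ[k] Module.End k W}
    {f' : B →ₐ[k] Module.End k V'} {g' : C →ₐ[k] Module.End k W'} {p : V →ₗ[k] V'}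
    {q : W →ₗ[k] W'} (hp : ∀ b, p ∘ₗ f b = f' b ∘ₗ p) (hq : ∀ c, q ∘ₗ g c = g' c ∘ₗ q)
    (z : B ⊗[k] C) :
    TensorProduct.map p q ∘ₗ pairAct f g z = pairAct f' g' z ∘ₗ TensorProduct.map p q := by
  induction z with
  | zero => simp
  | add x y hx hy => simp only [map_add, LinearMap.comp_add, LinearMap.add_comp, hx, hy]
  | tmul x y => simp only [pairAct_tmul, ← TensorProduct.map_comp, hp, hq]

theorem pairAct_comm (f : B →ₐ[k] Module.End k V) (g : C →ₐ[k] Module.End k W) (z : B ⊗[k] C) :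
    (TensorProduct.comm k V W).toLinearMap ∘ₗ pairAct f g z =
      pairAct g f (Algebra.TensorProduct.comm k B C z) ∘ₗ
        (TensorProduct.comm k V W).toLinearMap := by
  induction z with
  | zero => simp
  | add x y hx hy => simp only [map_add, LinearMap.comp_add, LinearMap.add_comp, hx, hy]
  | tmul x y => ext; rfl

/-- The linear automorphism by which a unit acts. -/
noncomputable def unitAct (f : B →ₐ[k] Module.End k V) (b : Bˣ) : V ≃ₗ[k] V :=
  LinearEquiv.ofLinearMap (f b.val) (f (b⁻¹).val)
    (by rw [← Module.End.mul_eq_comp, ← map_mul]; simp [Module.End.one_eq_id])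
    (by rw [← Module.End.mul_eq_comp, ← map_mul]; simp [Module.End.one_eq_id])

@[simp] theorem unitAct_toLinearMap (f : B →ₐ[k] Module.End k V) (b : Bˣ) :
    (unitAct f b).toLinearMap = f b.val := rfl

@[simp] theorem unitAct_symm_toLinearMap (f : B →ₐ[k] Module.End k V) (b : Bˣ) :
    (unitAct f b).symm.toLinearMap = f (b⁻¹).val := rfl

end PairAct

section Monoidal

variable {k : Type u} [CommRing k] {H : Type v} [Ring H] [Algebra k H]

/-- The action of `H ⊗ H` on `V ⊗ W`. -/
noncomputable abbrev act₂ (V W : HModule k H) : H ⊗[k] H →ₐ[k] Module.End k (V ⊗[k] W) :=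
  pairAct V.act W.act

/-- The action of `H ⊗ H ⊗ H` on `V ⊗ W ⊗ X`. -/
noncomputable abbrev act₃ (V W X : HModule k H) :
    H ⊗[k] (H ⊗[k] H) →ₐ[k] Module.End k (V ⊗[k] (W ⊗[k] X)) :=
  pairAct V.act (pairAct W.act X.act)

variable [QuasiHopfAlgebra k H]

open QuasiHopfAlgebra

/-- The `k`-module `V ⊗ W` with `h ▷ (v ⊗ w) = (h₁ ▷ v) ⊗ (h₂ ▷ w)`. -/
@[simps carrier addCommGroup module act]
noncomputable def tensor (V W : HModule k H) : HModule k H where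
  carrier := V ⊗[k] W
  act := (act₂ V W).comp comul

/-- The `k`-module `k` with `h ▷ c = ε(h) c`. -/
@[simps carrier addCommGroup module act]
noncomputable def unit : HModule k H where
  carrier := k
  act := (Algebra.lmul k k).comp counit

/-- `f ⊗ g` -/
noncomputable def tensorMap {V W V' W' : HModule k H} (f : V ⟶ V') (g : W ⟶ W') :
    tensor V W ⟶ tensor V' W' where
  lin := TensorProduct.map (lin f) (lin g)
  equivariant h := pairAct_naturality f.equivariant g.equivariant (comul h)

/-- The underlying linear equivalence of the associator,
`(v ⊗ w) ⊗ x ↦ (φ⁽¹⁾ ▷ v) ⊗ ((φ⁽²⁾ ▷ w) ⊗ (φ⁽³⁾ ▷ x))`. -/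
noncomputable def assocLin (V W X : HModule k H) :
    (V ⊗[k] W) ⊗[k] X ≃ₗ[k] V ⊗[k] (W ⊗[k] X) :=
  TensorProduct.assoc k V W X ≪≫ₗ unitAct (act₃ V W X) φ

theorem assocLin_toLinearMap (V W X : HModule k H) :
    (assocLin V W X).toLinearMap =
      act₃ V W X φ.val ∘ₗ (TensorProduct.assoc k V W X).toLinearMap := rfl

/-- The associator. -/
noncomputable def associator (V W X : HModule k H) :
    tensor (tensor V W) X ≅ tensor V (tensor W X) :=
  isoMk (assocLin V W X) fun h => by
    change _ ∘ₗ pairAct ((act₂ V W).comp comul) X.act (comul h) =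
      pairAct V.act ((act₂ W X).comp comul) (comul h) ∘ₗ _
    have e1 := pairAct_map_left (act₂ V W) X.act comul (comul (k := k) h)
    have e2 := pairAct_map_right V.act (act₂ W X) comul (comul (k := k) h)
    rw [← e1, ← e2, assocLin_toLinearMap, LinearMap.comp_assoc, pairAct_assoc,
      ← LinearMap.comp_assoc, ← LinearMap.comp_assoc, ← Module.End.mul_eq_comp,
      ← Module.End.mul_eq_comp, ← map_mul, ← map_mul, quasi_coassoc]

theorem lid_pairAct (V : HModule k H) (z : H ⊗[k] H) :
    (TensorProduct.lid k V).toLinearMap ∘ₗ pairAct ((Algebra.lmul k k).comp counit) V.act z =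
      V.act (Algebra.TensorProduct.lid k H
        (Algebra.TensorProduct.map counit (AlgHom.id k H) z)) ∘ₗ
        (TensorProduct.lid k V).toLinearMap := by
  induction z with
  | zero => simp
  | add x y hx hy => simp only [map_add, LinearMap.comp_add, LinearMap.add_comp, hx, hy]
  | tmul x y => ext; simp

theorem rid_pairAct (V : HModule k H) (z : H ⊗[k] H) :
    (TensorProduct.rid k V).toLinearMap ∘ₗ pairAct V.act ((Algebra.lmul k k).comp counit) z =
      V.act (Algebra.TensorProduct.rid k k H
        (Algebra.TensorProduct.map (AlgHom.id k H) counit z)) ∘ₗ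
        (TensorProduct.rid k V).toLinearMap := by
  induction z with
  | zero => simp
  | add x y hx hy => simp only [map_add, LinearMap.comp_add, LinearMap.add_comp, hx, hy]
  | tmul x y => ext; simp

/-- The left unitor `c ⊗ v ↦ c v`. -/
noncomputable def leftUnitor (V : HModule k H) : tensor unit V ≅ V :=
  isoMk (TensorProduct.lid k V) fun h => (lid_pairAct V (comul h)).trans (by rw [counit_comul]; rfl)

/-- The right unitor `v ⊗ c ↦ c v`. -/
noncomputable def rightUnitor (V : HModule k H) : tensor V unit ≅ V :=
  isoMk (TensorProduct.rid k V) fun h => (rid_pairAct V (comul h)).trans (by rw [comul_counit]; rfl)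

@[simps tensorObj tensorHom tensorUnit associator leftUnitor rightUnitor]
noncomputable instance : MonoidalCategoryStruct (HModule k H) where
  tensorObj := tensor
  whiskerLeft V _ _ f := tensorMap (𝟙 V) f
  whiskerRight f W := tensorMap f (𝟙 W)
  tensorHom := tensorMap
  tensorUnit := unit
  associator := associator
  leftUnitor := leftUnitor
  rightUnitor := rightUnitor

theorem act_tensorObj (V W : HModule k H) : (V ⊗ W).act = (act₂ V W).comp comul := rfl

theorem lin_tensorHom {V W V' W' : HModule k H} (f : V ⟶ V') (g : W ⟶ W') :
    lin (f ⊗ₘ g) = TensorProduct.map (lin f) (lin g) := rfl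

theorem lin_whiskerLeft (V : HModule k H) {W W' : HModule k H} (g : W ⟶ W') :
    lin (V ◁ g) = TensorProduct.map LinearMap.id (lin g) := rfl

theorem lin_whiskerRight {V V' : HModule k H} (f : V ⟶ V') (W : HModule k H) :
    lin (f ▷ W) = TensorProduct.map (lin f) LinearMap.id := rfl

theorem lin_associator_hom (V W X : HModule k H) :
    lin (α_ V W X).hom = act₃ V W X φ.val ∘ₗ (TensorProduct.assoc k V W X).toLinearMap := rfl

theorem lin_associator_inv (V W X : HModule k H) :
    lin (α_ V W X).inv =
      (TensorProduct.assoc k V W X).symm.toLinearMap ∘ₗ act₃ V W X (φ⁻¹).val := rfl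

theorem lin_leftUnitor_hom (V : HModule k H) :
    lin (λ_ V).hom = (TensorProduct.lid k V).toLinearMap := rfl

theorem lin_rightUnitor_hom (V : HModule k H) :
    lin (ρ_ V).hom = (TensorProduct.rid k V).toLinearMap := rfl

/-- The action of `H ⊗ H ⊗ H ⊗ H` on `V ⊗ W ⊗ X ⊗ Y`. -/
noncomputable abbrev act₄ (V W X Y : HModule k H) :
    H ⊗[k] (H ⊗[k] (H ⊗[k] H)) →ₐ[k] Module.End k (V ⊗[k] (W ⊗[k] (X ⊗[k] Y))) :=
  pairAct V.act (act₃ W X Y)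

theorem lin_associator_left (V W X Y : HModule k H) :
    lin (α_ (V ⊗ W) X Y).hom = pairAct (act₂ V W) (act₂ X Y)
      (Algebra.TensorProduct.map comul (AlgHom.id k _) φ.val) ∘ₗ
        (TensorProduct.assoc k (V ⊗[k] W) X Y).toLinearMap := by
  rw [pairAct_map_left]; rfl

theorem lin_associator_mid (V W X Y : HModule k H) :
    lin (α_ V (W ⊗ X) Y).hom = pairAct V.act (pairAct (act₂ W X) Y.act)
      (Algebra.TensorProduct.map (AlgHom.id k H)
        (Algebra.TensorProduct.map comul (AlgHom.id k _)) φ.val) ∘ₗ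
        (TensorProduct.assoc k V (W ⊗[k] X) Y).toLinearMap := by
  rw [pairAct_map_right]
  have e : (pairAct (act₂ W X) Y.act).comp (Algebra.TensorProduct.map comul (AlgHom.id k H)) =
      pairAct ((act₂ W X).comp comul) Y.act :=
    AlgHom.ext fun z => pairAct_map_left (act₂ W X) Y.act comul z
  rw [e]; rfl

theorem lin_associator_right (V W X Y : HModule k H) :
    lin (α_ V W (X ⊗ Y)).hom = act₄ V W X Y
      (Algebra.TensorProduct.map (AlgHom.id k H)
        (Algebra.TensorProduct.map (AlgHom.id k _) comul) φ.val) ∘ₗ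
        (TensorProduct.assoc k V W (X ⊗[k] Y)).toLinearMap := by
  rw [pairAct_map_right]
  have e : (act₃ W X Y).comp (Algebra.TensorProduct.map (AlgHom.id k H) comul) =
      pairAct W.act ((act₂ X Y).comp comul) :=
    AlgHom.ext fun z => pairAct_map_right W.act (act₂ X Y) comul z
  rw [e]; rfl

theorem pairAct_tmul_one {B C V W : Type*} [Ring B] [Algebra k B] [Ring C] [Algebra k C]
    [AddCommGroup V] [Module k V] [AddCommGroup W] [Module k W]
    (f : B →ₐ[k] Module.End k V) (g : C →ₐ[k] Module.End k W) (b : B) :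
    pairAct f g (b ⊗ₜ[k] 1) = TensorProduct.map (f b) LinearMap.id := by
  rw [pairAct_tmul, map_one]; rfl

theorem pairAct_one_tmul {B C V W : Type*} [Ring B] [Algebra k B] [Ring C] [Algebra k C]
    [AddCommGroup V] [Module k V] [AddCommGroup W] [Module k W]
    (f : B →ₐ[k] Module.End k V) (g : C →ₐ[k] Module.End k W) (c : C) :
    pairAct f g (1 ⊗ₜ[k] c) = TensorProduct.map LinearMap.id (g c) := by
  rw [pairAct_tmul, map_one]; rfl

theorem map_id_assoc_pairAct (V W X Y : HModule k H) (z : H ⊗[k] ((H ⊗[k] H) ⊗[k] H)) :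
    TensorProduct.map LinearMap.id (TensorProduct.assoc k W X Y).toLinearMap ∘ₗ
        pairAct V.act (pairAct (act₂ W X) Y.act) z =
      act₄ V W X Y (Algebra.TensorProduct.map (AlgHom.id k H)
        (Algebra.TensorProduct.assoc k k k H H H).toAlgHom z) ∘ₗ
        TensorProduct.map LinearMap.id (TensorProduct.assoc k W X Y).toLinearMap := by
  rw [pairAct_map_right]
  exact pairAct_naturality (f := V.act) (g := pairAct (act₂ W X) Y.act) (f' := V.act)
    (g' := (act₃ W X Y).comp (Algebra.TensorProduct.assoc k k k H H H).toAlgHom)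
    (p := LinearMap.id) (q := (TensorProduct.assoc k W X Y).toLinearMap) (fun _ => rfl)
    (fun c => pairAct_assoc W.act X.act Y.act c) z

theorem pentagon_lin (V W X Y : HModule k H) :
    lin (V ◁ (α_ W X Y).hom) ∘ₗ lin (α_ V (W ⊗ X) Y).hom ∘ₗ lin ((α_ V W X).hom ▷ Y) =
      lin (α_ V W (X ⊗ Y)).hom ∘ₗ lin (α_ (V ⊗ W) X Y).hom := by
  have h1 : lin ((α_ V W X).hom ▷ Y) = pairAct (act₃ V W X) Y.act (φ.val ⊗ₜ[k] 1) ∘ₗ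
      TensorProduct.map (TensorProduct.assoc k V W X).toLinearMap LinearMap.id := by
    rw [pairAct_tmul_one, ← TensorProduct.map_comp]; rfl
  have h2 : lin (V ◁ (α_ W X Y).hom) = act₄ V W X Y (1 ⊗ₜ[k] φ.val) ∘ₗ
      TensorProduct.map LinearMap.id (TensorProduct.assoc k W X Y).toLinearMap := by
    rw [pairAct_one_tmul, ← TensorProduct.map_comp]; rfl
  have h3 := pairAct_assoc V.act (act₂ W X) Y.act (φ.val ⊗ₜ[k] (1 : H))
  have h4 := pairAct_assoc V.act W.act (act₂ X Y)
    (Algebra.TensorProduct.map comul (AlgHom.id k _) (φ (k := k) (H := H)).val)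
  have e0 : (TensorProduct.assoc k V W (X ⊗[k] Y)).toLinearMap ∘ₗ
      (TensorProduct.assoc k (V ⊗[k] W) X Y).toLinearMap =
      TensorProduct.map LinearMap.id (TensorProduct.assoc k W X Y).toLinearMap ∘ₗ
        (TensorProduct.assoc k V (W ⊗[k] X) Y).toLinearMap ∘ₗ
          TensorProduct.map (TensorProduct.assoc k V W X).toLinearMap LinearMap.id := by
    apply TensorProduct.ext_fourfold
    intros; rfl
  rw [lin_associator_left, lin_associator_mid, lin_associator_right, h1, h2]
  have c := congrArg (act₄ V W X Y) (cocycle (k := k) (H := H))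
  rw [map_mul, map_mul, map_mul, Module.End.mul_eq_comp, Module.End.mul_eq_comp,
    Module.End.mul_eq_comp] at c
  calc _ = act₄ V W X Y (1 ⊗ₜ[k] φ.val) ∘ₗ
        (TensorProduct.map LinearMap.id (TensorProduct.assoc k W X Y).toLinearMap ∘ₗ
          pairAct V.act (pairAct (act₂ W X) Y.act)
            (Algebra.TensorProduct.map (AlgHom.id k H)
              (Algebra.TensorProduct.map comul (AlgHom.id k _)) φ.val)) ∘ₗ
          ((TensorProduct.assoc k V (W ⊗[k] X) Y).toLinearMap ∘ₗ
            pairAct (act₃ V W X) Y.act (φ.val ⊗ₜ[k] 1)) ∘ₗ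
          TensorProduct.map (TensorProduct.assoc k V W X).toLinearMap LinearMap.id := rfl
    _ = _ := ?_
  rw [h3, map_id_assoc_pairAct]
  calc _ = (act₄ V W X Y (1 ⊗ₜ[k] φ.val) ∘ₗ
        act₄ V W X Y (Algebra.TensorProduct.map (AlgHom.id k H)
          (Algebra.TensorProduct.assoc k k k H H H).toAlgHom
          (Algebra.TensorProduct.map (AlgHom.id k H)
              (Algebra.TensorProduct.map comul (AlgHom.id k _)) φ.val)) ∘ₗ
        (TensorProduct.map LinearMap.id (TensorProduct.assoc k W X Y).toLinearMap ∘ₗ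
          pairAct V.act (pairAct (act₂ W X) Y.act)
            (Algebra.TensorProduct.assoc k k k H (H ⊗[k] H) H (φ.val ⊗ₜ[k] 1)))) ∘ₗ
          ((TensorProduct.assoc k V (W ⊗[k] X) Y).toLinearMap ∘ₗ
          TensorProduct.map (TensorProduct.assoc k V W X).toLinearMap LinearMap.id) := rfl
    _ = (act₄ V W X Y (1 ⊗ₜ[k] φ.val) ∘ₗ
        act₄ V W X Y (Algebra.TensorProduct.map (AlgHom.id k H)
          ((Algebra.TensorProduct.assoc k k k H H H).toAlgHom.comp
              (Algebra.TensorProduct.map comul (AlgHom.id k _))) φ.val) ∘ₗ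
          act₄ V W X Y (Algebra.TensorProduct.map (AlgHom.id k H)
            (Algebra.TensorProduct.assoc k k k H H H).toAlgHom
            (Algebra.TensorProduct.assoc k k k H (H ⊗[k] H) H (φ.val ⊗ₜ[k] 1)))) ∘ₗ
        TensorProduct.map LinearMap.id (TensorProduct.assoc k W X Y).toLinearMap ∘ₗ
          (TensorProduct.assoc k V (W ⊗[k] X) Y).toLinearMap ∘ₗ
          TensorProduct.map (TensorProduct.assoc k V W X).toLinearMap LinearMap.id := by
        rw [map_id_assoc_pairAct, Algebra.TensorProduct.map_id_comp]
        rfl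
    _ = _ := by
        rw [← LinearMap.comp_assoc (act₄ V W X Y _), ← c, ← e0]
        calc _ = act₄ V W X Y (Algebra.TensorProduct.map (AlgHom.id k H)
                (Algebra.TensorProduct.map (AlgHom.id k _) comul) φ.val) ∘ₗ
              (act₄ V W X Y (Algebra.TensorProduct.assoc k k k H H (H ⊗[k] H)
                (Algebra.TensorProduct.map comul (AlgHom.id k (H ⊗[k] H)) φ.val)) ∘ₗ
                (TensorProduct.assoc k V W (X ⊗[k] Y)).toLinearMap) ∘ₗ
              (TensorProduct.assoc k (V ⊗[k] W) X Y).toLinearMap := rfl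
          _ = _ := by rw [← h4]; rfl

theorem triangle_lin (V W : HModule k H) :
    lin (V ◁ (λ_ W).hom) ∘ₗ lin (α_ V (𝟙_ (HModule k H)) W).hom = lin ((ρ_ V).hom ▷ W) := by
  have n := pairAct_naturality (f := V.act) (g := pairAct ((Algebra.lmul k k).comp counit) W.act)
    (f' := V.act) (g' := W.act.comp ((Algebra.TensorProduct.lid k H).toAlgHom.comp
        (Algebra.TensorProduct.map counit (AlgHom.id k H))))
    (p := LinearMap.id) (q := (TensorProduct.lid k W).toLinearMap) (fun _ => rfl)
    (lid_pairAct W) (φ (k := k) (H := H)).val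
  rw [← pairAct_map_right, counit_φ, map_one] at n
  calc _ = (TensorProduct.map LinearMap.id (TensorProduct.lid k W).toLinearMap ∘ₗ
        pairAct V.act (pairAct ((Algebra.lmul k k).comp counit) W.act) φ.val) ∘ₗ
        (TensorProduct.assoc k V k W).toLinearMap := rfl
    _ = TensorProduct.map LinearMap.id (TensorProduct.lid k W).toLinearMap ∘ₗ
        (TensorProduct.assoc k V k W).toLinearMap := by rw [n]; rfl
    _ = TensorProduct.map (TensorProduct.rid k V).toLinearMap LinearMap.id := by
        ext; simp
    _ = _ := rfl

noncomputable instance : MonoidalCategory (HModule k H) :=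
  MonoidalCategory.ofTensorHom
    (id_tensorHom_id := fun _ _ => hom_ext TensorProduct.map_id)
    (id_tensorHom := fun _ _ _ _ => rfl)
    (tensorHom_id := fun _ _ => rfl)
    (tensorHom_comp_tensorHom := fun _ _ _ _ => hom_ext (TensorProduct.map_comp _ _ _ _).symm)
    (associator_naturality := fun {V W X V' W' X'} f g h => by
      apply hom_ext
      have e := pairAct_naturality f.equivariant
        (pairAct_naturality g.equivariant h.equivariant) (φ (k := k) (H := H)).val
      simp only [lin_comp, lin_tensorHom, lin_associator_hom]
      erw [← LinearMap.comp_assoc, e, LinearMap.comp_assoc, LinearMap.comp_assoc]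
      congr 1
      exact (TensorProduct.map_map_comp_assoc_eq (lin f) (lin g) (lin h)).symm)
    (leftUnitor_naturality := fun f => by
      apply hom_ext
      exact TensorProduct.ext' fun c v => ((lin f).map_smul c v).symm)
    (rightUnitor_naturality := fun f => by
      apply hom_ext
      exact TensorProduct.ext' fun v c => ((lin f).map_smul c v).symm)
    (pentagon := fun V W X Y => by
      apply hom_ext
      exact pentagon_lin V W X Y)
    (triangle := fun V W => by
      apply hom_ext
      exact triangle_lin V W)

end Monoidal

end HModule

namespace HModule

section Braided

variable {k : Type u} [CommRing k] {H : Type v} [Ring H] [Algebra k H]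

theorem act₃_swap12 (V W X : HModule k H) (z : H ⊗[k] (H ⊗[k] H)) :
    act₃ W V X z ∘ₗ (TensorProduct.leftComm k V W X).toLinearMap =
      (TensorProduct.leftComm k V W X).toLinearMap ∘ₗ act₃ V W X (swap12 z) := by
  induction z with
  | zero => simp
  | add x y hx hy => simp only [map_add, LinearMap.comp_add, LinearMap.add_comp, hx, hy]
  | tmul x y =>
    induction y with
    | zero => simp
    | add y y' hx hy =>
      simp only [TensorProduct.tmul_add, map_add, LinearMap.comp_add, LinearMap.add_comp, hx, hy]
    | tmul y t => ext; rfl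

theorem act₃_swap23 (V W X : HModule k H) (z : H ⊗[k] (H ⊗[k] H)) :
    act₃ V X W z ∘ₗ TensorProduct.map LinearMap.id (TensorProduct.comm k W X).toLinearMap =
      TensorProduct.map LinearMap.id (TensorProduct.comm k W X).toLinearMap ∘ₗ
        act₃ V W X (swap23 z) := by
  induction z with
  | zero => simp
  | add x y hx hy => simp only [map_add, LinearMap.comp_add, LinearMap.add_comp, hx, hy]
  | tmul x y =>
    induction y with
    | zero => simp
    | add y y' hx hy =>
      simp only [TensorProduct.tmul_add, map_add, LinearMap.comp_add, LinearMap.add_comp, hx, hy]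
    | tmul y t => ext; rfl

theorem swap12_one_tmul (z : H ⊗[k] H) : swap12 ((1 : H) ⊗ₜ[k] z) =
    Algebra.TensorProduct.map (AlgHom.id k H) Algebra.TensorProduct.includeRight z := by
  induction z with
  | zero => simp
  | add x y hx hy => simp only [TensorProduct.tmul_add, map_add, hx, hy]
  | tmul x y => rfl

theorem swap23_tmul_one (z : H ⊗[k] H) :
    swap23 (Algebra.TensorProduct.assoc k k k H H H (z ⊗ₜ[k] 1)) =
    Algebra.TensorProduct.map (AlgHom.id k H) Algebra.TensorProduct.includeRight z := by
  induction z with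
  | zero => simp
  | add x y hx hy => simp only [TensorProduct.add_tmul, map_add, hx, hy]
  | tmul x y => rfl

variable [QuasitriangularQuasiHopfAlgebra k H]

open QuasiHopfAlgebra QuasitriangularQuasiHopfAlgebra

/-- The braiding `v ⊗ w ↦ (R⁽²⁾ ▷ w) ⊗ (R⁽¹⁾ ▷ v)`. -/
noncomputable def braiding (V W : HModule k H) : V ⊗ W ≅ W ⊗ V :=
  isoMk (unitAct (act₂ V W) R ≪≫ₗ TensorProduct.comm k V W) fun h => by
    have e := comul_op (k := k) h
    rw [Units.eq_mul_inv_iff_mul_eq] at e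
    have c := pairAct_comm V.act W.act (Algebra.TensorProduct.comm k H H (comul (k := k) h))
    have i : Algebra.TensorProduct.comm k H H
        (Algebra.TensorProduct.comm k H H (comul (k := k) h)) = comul h :=
      (TensorProduct.comm k H H).symm_apply_apply _
    rw [i] at c
    calc _ = (TensorProduct.comm k V W).toLinearMap ∘ₗ act₂ V W (R.val * comul h) := by
          rw [map_mul]; rfl
      _ = ((TensorProduct.comm k V W).toLinearMap ∘ₗ
          act₂ V W (Algebra.TensorProduct.comm k H H (comul h))) ∘ₗ act₂ V W R.val := by
          rw [← e, map_mul]; rfl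
      _ = _ := by rw [c]; rfl

theorem lin_braiding (V W : HModule k H) :
    lin (braiding V W).hom = (TensorProduct.comm k V W).toLinearMap ∘ₗ act₂ V W R.val := rfl

theorem braiding_naturality {V W V' W' : HModule k H} (f : V ⟶ V') (g : W ⟶ W') :
    (f ⊗ₘ g) ≫ (braiding V' W').hom = (braiding V W).hom ≫ (g ⊗ₘ f) := by
  apply hom_ext
  have n := pairAct_naturality f.equivariant g.equivariant
    (QuasitriangularQuasiHopfAlgebra.R (k := k) (H := H)).val
  have c : (TensorProduct.comm k V' W').toLinearMap ∘ₗ TensorProduct.map (lin f) (lin g) =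
      TensorProduct.map (lin g) (lin f) ∘ₗ (TensorProduct.comm k V W).toLinearMap := by
    ext; rfl
  calc _ = (TensorProduct.comm k V' W').toLinearMap ∘ₗ
        (act₂ V' W' R.val ∘ₗ TensorProduct.map (lin f) (lin g)) := rfl
    _ = ((TensorProduct.comm k V' W').toLinearMap ∘ₗ TensorProduct.map (lin f) (lin g)) ∘ₗ
        act₂ V W R.val := by erw [← n]; rfl
    _ = _ := by rw [c]; rfl

theorem unit_cancel {A : Type*} [Ring A] {p p' q q' a b c : A} (hp : p * p' = 1)
    (hq : q' * q = 1) : p * (p' * a * b * c * q') * q = a * b * c := by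
  calc _ = (p * p') * a * b * c * (q' * q) := by simp only [mul_assoc]
    _ = _ := by rw [hp, hq, one_mul, mul_one]

theorem hexagon_forward (X Y Z : HModule k H) :
    (α_ X Y Z).hom ≫ (braiding X (Y ⊗ Z)).hom ≫ (α_ Y Z X).hom =
      ((braiding X Y).hom ▷ Z) ≫ (α_ Y X Z).hom ≫ (Y ◁ (braiding X Z).hom) := by
  apply hom_ext
  have key : swap12 (swap23 φ.val) * Algebra.TensorProduct.map (AlgHom.id k H) comul R.val *
      φ.val = swap12 ((1 : H) ⊗ₜ[k] R.val) * swap12 φ.val *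
      Algebra.TensorProduct.assoc k k k H H H (R.val ⊗ₜ[k] (1 : H)) := by
    rw [id_comul_R, swap12_one_tmul]
    exact unit_cancel (by rw [← map_mul, ← map_mul, Units.mul_inv, map_one, map_one])
      (Units.inv_mul _)
  have key' := congrArg (act₃ X Y Z) key
  rw [map_mul, map_mul, map_mul, map_mul] at key'
  have c1 := act₃_swap12 X Y Z (swap23 (φ (k := k) (H := H)).val)
  have s1 := act₃_swap12 X Y Z (φ (k := k) (H := H)).val
  have s2 := act₃_swap12 X Y Z ((1 : H) ⊗ₜ[k] R.val)
  have c2 := act₃_swap23 Y X Z (φ (k := k) (H := H)).val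
  have r := pairAct_assoc X.act Y.act Z.act ((R (k := k) (H := H)).val ⊗ₜ[k] (1 : H))
  let L := (TensorProduct.leftComm k X Y Z).toLinearMap
  let D : Y.carrier ⊗[k] (X.carrier ⊗[k] Z.carrier) →ₗ[k]
      Y.carrier ⊗[k] (Z.carrier ⊗[k] X.carrier) :=
    TensorProduct.map LinearMap.id (TensorProduct.comm k X Z).toLinearMap
  let As := (TensorProduct.assoc k X Y Z).toLinearMap
  have p1 : (TensorProduct.assoc k Y Z X).toLinearMap ∘ₗ
      (TensorProduct.comm k X (Y ⊗[k] Z)).toLinearMap = D ∘ₗ L := by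
    apply TensorProduct.ext_threefold'
    intros; rfl
  have p2 : (TensorProduct.assoc k Y X Z).toLinearMap ∘ₗ
      TensorProduct.map (TensorProduct.comm k X Y).toLinearMap LinearMap.id = L ∘ₗ As := by
    apply TensorProduct.ext_threefold
    intros; rfl
  have b1 : lin (braiding X (Y ⊗ Z)).hom = (TensorProduct.comm k X (Y ⊗[k] Z)).toLinearMap ∘ₗ
      act₃ X Y Z (Algebra.TensorProduct.map (AlgHom.id k H) comul R.val) := by
    rw [pairAct_map_right]; rfl
  have b2 : lin ((braiding X Y).hom ▷ Z) =
      TensorProduct.map (TensorProduct.comm k X Y).toLinearMap LinearMap.id ∘ₗ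
        pairAct (act₂ X Y) Z.act (R.val ⊗ₜ[k] 1) := by
    rw [pairAct_tmul_one, ← TensorProduct.map_comp]; rfl
  have b3 : lin (Y ◁ (braiding X Z).hom) = D ∘ₗ act₃ Y X Z (1 ⊗ₜ[k] R.val) := by
    rw [pairAct_one_tmul, ← TensorProduct.map_comp]; rfl
  change act₃ Y Z X φ.val ∘ₗ (TensorProduct.assoc k Y Z X).toLinearMap ∘ₗ
    lin (braiding X (Y ⊗ Z)).hom ∘ₗ act₃ X Y Z φ.val ∘ₗ As =
    lin (Y ◁ (braiding X Z).hom) ∘ₗ act₃ Y X Z φ.val ∘ₗ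
    (TensorProduct.assoc k Y X Z).toLinearMap ∘ₗ lin ((braiding X Y).hom ▷ Z)
  rw [b1, b2, b3]
  calc _ = act₃ Y Z X φ.val ∘ₗ ((TensorProduct.assoc k Y Z X).toLinearMap ∘ₗ
        (TensorProduct.comm k X (Y ⊗[k] Z)).toLinearMap) ∘ₗ
        act₃ X Y Z (Algebra.TensorProduct.map (AlgHom.id k H) comul R.val) ∘ₗ
          act₃ X Y Z φ.val ∘ₗ As := rfl
    _ = (act₃ Y Z X φ.val ∘ₗ D) ∘ₗ L ∘ₗ
        act₃ X Y Z (Algebra.TensorProduct.map (AlgHom.id k H) comul R.val) ∘ₗ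
          act₃ X Y Z φ.val ∘ₗ As := by rw [p1]; rfl
    _ = D ∘ₗ (act₃ Y X Z (swap23 φ.val) ∘ₗ L) ∘ₗ
        act₃ X Y Z (Algebra.TensorProduct.map (AlgHom.id k H) comul R.val) ∘ₗ
          act₃ X Y Z φ.val ∘ₗ As := by rw [c2]; rfl
    _ = D ∘ₗ L ∘ₗ (act₃ X Y Z (swap12 (swap23 φ.val)) *
        act₃ X Y Z (Algebra.TensorProduct.map (AlgHom.id k H) comul R.val) *
          act₃ X Y Z φ.val) ∘ₗ As := by rw [c1]; rfl
    _ = D ∘ₗ (L ∘ₗ act₃ X Y Z (swap12 ((1 : H) ⊗ₜ[k] R.val))) ∘ₗ act₃ X Y Z (swap12 φ.val) ∘ₗ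
          act₃ X Y Z (Algebra.TensorProduct.assoc k k k H H H (R.val ⊗ₜ[k] (1 : H))) ∘ₗ As := by
        rw [key']; rfl
    _ = D ∘ₗ act₃ Y X Z ((1 : H) ⊗ₜ[k] R.val) ∘ₗ (L ∘ₗ act₃ X Y Z (swap12 φ.val)) ∘ₗ
          act₃ X Y Z (Algebra.TensorProduct.assoc k k k H H H (R.val ⊗ₜ[k] (1 : H))) ∘ₗ As := by
        rw [← s2]; rfl
    _ = D ∘ₗ act₃ Y X Z ((1 : H) ⊗ₜ[k] R.val) ∘ₗ act₃ Y X Z φ.val ∘ₗ L ∘ₗ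
          act₃ X Y Z (Algebra.TensorProduct.assoc k k k H H H (R.val ⊗ₜ[k] (1 : H))) ∘ₗ As := by
        rw [← s1]; rfl
    _ = D ∘ₗ act₃ Y X Z ((1 : H) ⊗ₜ[k] R.val) ∘ₗ act₃ Y X Z φ.val ∘ₗ (L ∘ₗ
          As) ∘ₗ pairAct (act₂ X Y) Z.act (R.val ⊗ₜ[k] 1) := by
        rw [← r]; rfl
    _ = _ := by rw [← p2]; rfl

theorem hexagon_reverse (X Y Z : HModule k H) :
    (α_ X Y Z).inv ≫ (braiding (X ⊗ Y) Z).hom ≫ (α_ Z X Y).inv =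
      (X ◁ (braiding Y Z).hom) ≫ (α_ X Z Y).inv ≫ ((braiding X Z).hom ▷ Y) := by
  apply hom_ext
  have key : swap23 (swap12 (φ⁻¹).val) * Algebra.TensorProduct.assoc k k k H H H
        (Algebra.TensorProduct.map comul (AlgHom.id k H) R.val) *
      (φ⁻¹).val = swap23 (Algebra.TensorProduct.assoc k k k H H H (R.val ⊗ₜ[k] (1 : H))) *
      swap23 (φ⁻¹).val * ((1 : H) ⊗ₜ[k] R.val) := by
    rw [comul_id_R, swap23_tmul_one]
    exact unit_cancel (by rw [← map_mul, ← map_mul, Units.inv_mul, map_one, map_one])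
      (Units.mul_inv _)
  have key' := congrArg (act₃ X Y Z) key
  rw [map_mul, map_mul, map_mul, map_mul] at key'
  have c1 := act₃_swap23 X Y Z (swap12 ((φ (k := k) (H := H))⁻¹).val)
  have c2 := act₃_swap12 X Z Y ((φ (k := k) (H := H))⁻¹).val
  have s1 := act₃_swap23 X Y Z ((φ (k := k) (H := H))⁻¹).val
  have s2 := act₃_swap23 X Y Z
    (Algebra.TensorProduct.assoc k k k H H H ((R (k := k) (H := H)).val ⊗ₜ[k] (1 : H)))
  have r := pairAct_assoc X.act Z.act Y.act ((R (k := k) (H := H)).val ⊗ₜ[k] (1 : H))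
  have r2 := pairAct_assoc X.act Y.act Z.act
    (Algebra.TensorProduct.map comul (AlgHom.id k H) (R (k := k) (H := H)).val)
  let L := (TensorProduct.leftComm k X Z Y).toLinearMap
  let D : X.carrier ⊗[k] (Y.carrier ⊗[k] Z.carrier) →ₗ[k]
      X.carrier ⊗[k] (Z.carrier ⊗[k] Y.carrier) :=
    TensorProduct.map LinearMap.id (TensorProduct.comm k Y Z).toLinearMap
  let As := (TensorProduct.assoc k Z X Y).symm.toLinearMap
  let At := (TensorProduct.assoc k X Z Y).symm.toLinearMap
  let Au := (TensorProduct.assoc k X Y Z).symm.toLinearMap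
  have sy : ∀ {M N : Type u} [AddCommGroup M] [AddCommGroup N] [Module k M] [Module k N]
      (e : M ≃ₗ[k] N) (f : M →ₗ[k] M) (g : N →ₗ[k] N),
      e.toLinearMap ∘ₗ f = g ∘ₗ e.toLinearMap → e.symm.toLinearMap ∘ₗ g = f ∘ₗ
        e.symm.toLinearMap := by
    intro M N _ _ _ _ e f g h
    ext x
    have := LinearMap.congr_fun h (e.symm x)
    simp at this
    simp [← this]
  have r' := sy _ _ _ r
  have r2' := sy _ _ _ r2
  have p1 : (TensorProduct.comm k (X ⊗[k] Y) Z).toLinearMap ∘ₗ Au = L ∘ₗ D := by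
    apply TensorProduct.ext_threefold'
    intros; rfl
  have p2 : TensorProduct.map (TensorProduct.comm k X Z).toLinearMap LinearMap.id ∘ₗ At =
      As ∘ₗ L := by
    apply TensorProduct.ext_threefold'
    intros; rfl
  have b1 : lin (braiding (X ⊗ Y) Z).hom = (TensorProduct.comm k (X ⊗[k] Y) Z).toLinearMap ∘ₗ
      pairAct (act₂ X Y) Z.act (Algebra.TensorProduct.map comul (AlgHom.id k H) R.val) := by
    rw [pairAct_map_left]; rfl
  have b2 : lin ((braiding X Z).hom ▷ Y) =
      TensorProduct.map (TensorProduct.comm k X Z).toLinearMap LinearMap.id ∘ₗ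
        pairAct (act₂ X Z) Y.act (R.val ⊗ₜ[k] 1) := by
    rw [pairAct_tmul_one, ← TensorProduct.map_comp]; rfl
  have b3 : lin (X ◁ (braiding Y Z).hom) = D ∘ₗ act₃ X Y Z (1 ⊗ₜ[k] R.val) := by
    rw [pairAct_one_tmul, ← TensorProduct.map_comp]; rfl
  change As ∘ₗ act₃ Z X Y (φ⁻¹).val ∘ₗ lin (braiding (X ⊗ Y) Z).hom ∘ₗ Au ∘ₗ
    act₃ X Y Z (φ⁻¹).val = lin ((braiding X Z).hom ▷ Y) ∘ₗ At ∘ₗ act₃ X Z Y (φ⁻¹).val ∘ₗ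
      lin (X ◁ (braiding Y Z).hom)
  rw [b1, b2, b3]
  let G := act₃ X Y Z (Algebra.TensorProduct.assoc k k k H H H
        (Algebra.TensorProduct.map comul (AlgHom.id k H) R.val))
  calc _ = As ∘ₗ act₃ Z X Y (φ⁻¹).val ∘ₗ (TensorProduct.comm k (X ⊗[k] Y) Z).toLinearMap ∘ₗ
        (pairAct (act₂ X Y) Z.act (Algebra.TensorProduct.map comul (AlgHom.id k H) R.val) ∘ₗ
          Au) ∘ₗ act₃ X Y Z (φ⁻¹).val := rfl
    _ = As ∘ₗ act₃ Z X Y (φ⁻¹).val ∘ₗ ((TensorProduct.comm k (X ⊗[k] Y) Z).toLinearMap ∘ₗ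
        Au) ∘ₗ G ∘ₗ act₃ X Y Z (φ⁻¹).val := by rw [← r2']; rfl
    _ = As ∘ₗ (act₃ Z X Y (φ⁻¹).val ∘ₗ L) ∘ₗ D ∘ₗ G ∘ₗ act₃ X Y Z (φ⁻¹).val := by rw [p1]; rfl
    _ = As ∘ₗ L ∘ₗ (act₃ X Z Y (swap12 (φ⁻¹).val) ∘ₗ D) ∘ₗ G ∘ₗ act₃ X Y Z (φ⁻¹).val := by
        rw [c2]; rfl
    _ = As ∘ₗ L ∘ₗ D ∘ₗ (act₃ X Y Z (swap23 (swap12 (φ⁻¹).val)) * G *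
          act₃ X Y Z (φ⁻¹).val) := by rw [c1]; rfl
    _ = As ∘ₗ L ∘ₗ (D ∘ₗ act₃ X Y Z (swap23 (Algebra.TensorProduct.assoc k k k H H H
          (R.val ⊗ₜ[k] (1 : H))))) ∘ₗ act₃ X Y Z (swap23 (φ⁻¹).val) ∘ₗ
          act₃ X Y Z ((1 : H) ⊗ₜ[k] R.val) := by rw [key']; rfl
    _ = As ∘ₗ L ∘ₗ act₃ X Z Y (Algebra.TensorProduct.assoc k k k H H H
          (R.val ⊗ₜ[k] (1 : H))) ∘ₗ (D ∘ₗ act₃ X Y Z (swap23 (φ⁻¹).val)) ∘ₗ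
          act₃ X Y Z ((1 : H) ⊗ₜ[k] R.val) := by rw [← s2]; rfl
    _ = (As ∘ₗ L) ∘ₗ act₃ X Z Y (Algebra.TensorProduct.assoc k k k H H H
          (R.val ⊗ₜ[k] (1 : H))) ∘ₗ act₃ X Z Y (φ⁻¹).val ∘ₗ D ∘ₗ
          act₃ X Y Z ((1 : H) ⊗ₜ[k] R.val) := by rw [← s1]; rfl
    _ = TensorProduct.map (TensorProduct.comm k X Z).toLinearMap LinearMap.id ∘ₗ
          (At ∘ₗ act₃ X Z Y (Algebra.TensorProduct.assoc k k k H H H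
          (R.val ⊗ₜ[k] (1 : H)))) ∘ₗ act₃ X Z Y (φ⁻¹).val ∘ₗ D ∘ₗ
          act₃ X Y Z ((1 : H) ⊗ₜ[k] R.val) := by rw [← p2]; rfl
    _ = _ := by rw [r']; rfl

noncomputable instance : BraidedCategory (HModule k H) where
  braiding := braiding
  braiding_naturality_right X _ _ f := by
    rw [← id_tensorHom, ← tensorHom_id, braiding_naturality]
  braiding_naturality_left f Z := by
    rw [← id_tensorHom, ← tensorHom_id, braiding_naturality]
  hexagon_forward := hexagon_forward
  hexagon_reverse := hexagon_reverse

end Braided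

end HModule

namespace QuasiHopfAlgebra

variable {k : Type u} [CommRing k] {H : Type v} [Ring H] [Algebra k H] [QuasiHopfAlgebra k H]

theorem antipode_one : antipode (k := k) (1 : H) = 1 := by
  have h := antipode_anti (k := k) ((antipode (k := k) (H := H)).symm 1) 1
  simpa using h.symm

/-- The algebra map `(id ⊗ id ⊗ ε)`. -/
noncomputable def counit₃ : H ⊗[k] (H ⊗[k] H) →ₐ[k] H ⊗[k] H :=
  Algebra.TensorProduct.map (AlgHom.id k H) ((Algebra.TensorProduct.rid k k H).toAlgHom.comp
    (Algebra.TensorProduct.map (AlgHom.id k H) counit))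

/-- The algebra map `(id ⊗ ε ⊗ id)`. -/
noncomputable def counit₂ : H ⊗[k] (H ⊗[k] H) →ₐ[k] H ⊗[k] H :=
  Algebra.TensorProduct.map (AlgHom.id k H) ((Algebra.TensorProduct.lid k H).toAlgHom.comp
    (Algebra.TensorProduct.map counit (AlgHom.id k H)))

theorem counit₂_φ : counit₂ (φ (k := k) (H := H)).val = 1 := counit_φ

theorem map_inv_eq_one {A B : Type*} [Ring A] [Ring B] [Algebra k A] [Algebra k B]
    (f : A →ₐ[k] B) (a : Aˣ) (h : f a.val = 1) : f (a⁻¹).val = 1 := by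
  have := map_mul f a.val (a⁻¹).val
  rw [Units.mul_inv, map_one, h, one_mul] at this
  exact this.symm

theorem lid_comul : ((Algebra.TensorProduct.lid k H).toAlgHom.comp
    (Algebra.TensorProduct.map counit (AlgHom.id k H))).comp comul = AlgHom.id k H :=
  AlgHom.ext counit_comul

theorem rid_comul : ((Algebra.TensorProduct.rid k k H).toAlgHom.comp
    (Algebra.TensorProduct.map (AlgHom.id k H) counit)).comp comul = AlgHom.id k H :=
  AlgHom.ext comul_counit

theorem counit₃_φ : counit₃ (φ (k := k) (H := H)).val = 1 := by
  have c := congrArg (Algebra.TensorProduct.map (AlgHom.id k H) (counit₂ (k := k) (H := H)))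
    (cocycle (k := k) (H := H))
  rw [map_mul, map_mul, map_mul] at c
  have l1 : ∀ z : H ⊗[k] (H ⊗[k] H), Algebra.TensorProduct.map (AlgHom.id k H)
      (counit₂ (k := k) (H := H)) (Algebra.TensorProduct.map (AlgHom.id k H)
        (Algebra.TensorProduct.map (AlgHom.id k H) comul) z) = z := by
    intro z
    induction z with
    | zero => simp
    | add x y hx hy => simp only [map_add, hx, hy]
    | tmul x y =>
      induction y with
      | zero => simp
      | add y y' hx hy => simp only [TensorProduct.tmul_add, map_add, hx, hy]
      | tmul y t =>
        have := counit_comul (k := k) t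
        simp [counit₂, this]
  have l2 : ∀ z : H ⊗[k] (H ⊗[k] H), Algebra.TensorProduct.map (AlgHom.id k H)
      (counit₂ (k := k) (H := H)) (Algebra.TensorProduct.assoc k k k H H (H ⊗[k] H)
        (Algebra.TensorProduct.map comul (AlgHom.id k (H ⊗[k] H)) z)) =
      Algebra.TensorProduct.assoc k k k H H H
        (Algebra.TensorProduct.map comul (AlgHom.id k H) (counit₂ z)) := by
    intro z
    induction z with
    | zero => simp
    | add x y hx hy => simp only [map_add, hx, hy]
    | tmul x y =>
      induction y with
      | zero => simp
      | add y y' hx hy => simp only [TensorProduct.tmul_add, map_add, hx, hy]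
      | tmul y t =>
        simp only [Algebra.TensorProduct.map_tmul, AlgHom.id_apply, counit₂]
        generalize comul (k := k) x = w
        induction w with
        | zero => simp
        | add x y hx hy => simp only [TensorProduct.add_tmul, map_add, hx, hy]
        | tmul x y => simp
  have l3 : ∀ z : H ⊗[k] (H ⊗[k] H), Algebra.TensorProduct.map (AlgHom.id k H)
      (counit₂ (k := k) (H := H)) (Algebra.TensorProduct.map (AlgHom.id k H)
        ((Algebra.TensorProduct.assoc k k k H H H).toAlgHom.comp
          (Algebra.TensorProduct.map comul (AlgHom.id k H))) z) = z := by
    intro z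
    induction z with
    | zero => simp
    | add x y hx hy => simp only [map_add, hx, hy]
    | tmul x y =>
      induction y with
      | zero => simp
      | add y y' hx hy => simp only [TensorProduct.tmul_add, map_add, hx, hy]
      | tmul y t =>
        have h := comul_counit (k := k) y
        have key : ∀ w : H ⊗[k] H, counit₂ (k := k)
            (Algebra.TensorProduct.assoc k k k H H H (w ⊗ₜ[k] t)) =
            (Algebra.TensorProduct.rid k k H
              (Algebra.TensorProduct.map (AlgHom.id k H) counit w)) ⊗ₜ[k] t := by
          intro w
          induction w with
          | zero => simp
          | add x y hx hy => simp only [TensorProduct.add_tmul, map_add, hx, hy]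
          | tmul x y => simp [counit₂, TensorProduct.smul_tmul]
        have e := key (comul y)
        rw [h] at e
        simp only [Algebra.TensorProduct.map_tmul, AlgHom.id_apply, AlgHom.comp_apply]
        exact congrArg (x ⊗ₜ[k] ·) e
  have l4 : ∀ z : H ⊗[k] (H ⊗[k] H), Algebra.TensorProduct.map (AlgHom.id k H)
      (counit₂ (k := k) (H := H)) (Algebra.TensorProduct.map (AlgHom.id k H)
        (Algebra.TensorProduct.assoc k k k H H H).toAlgHom
        (Algebra.TensorProduct.assoc k k k H (H ⊗[k] H) H (z ⊗ₜ[k] (1 : H)))) =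
      Algebra.TensorProduct.assoc k k k H H H (counit₃ z ⊗ₜ[k] 1) := by
    intro z
    induction z with
    | zero => simp
    | add x y hx hy => simp only [TensorProduct.add_tmul, map_add, hx, hy]
    | tmul x y =>
      induction y with
      | zero => simp
      | add y y' hx hy => simp only [TensorProduct.add_tmul, TensorProduct.tmul_add, map_add, hx, hy]
      | tmul y t => simp [counit₂, counit₃, TensorProduct.smul_tmul]
  rw [l1, l2, l3, l4, counit₂_φ, map_one, map_one, mul_one, Algebra.TensorProduct.map_tmul,
    counit₂_φ, AlgHom.id_apply, ← Algebra.TensorProduct.one_def, one_mul] at c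
  have c1 : Algebra.TensorProduct.assoc k k k H H H
      (counit₃ (φ (k := k) (H := H)).val ⊗ₜ[k] 1) = 1 := by
    have := congrArg (fun x => (φ (k := k) (H := H))⁻¹.val * x) c
    simpa [← mul_assoc] using this.symm
  have c2 : ∀ z : H ⊗[k] H, counit₃ (k := k)
      (Algebra.TensorProduct.assoc k k k H H H (z ⊗ₜ[k] 1)) = z := by
    intro z
    induction z with
    | zero => simp
    | add x y hx hy => simp only [TensorProduct.add_tmul, map_add, hx, hy]
    | tmul x y => simp [counit₃]
  have := congrArg (counit₃ (k := k) (H := H)) c1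
  rwa [c2, map_one] at this

/-- The linear map `x ⊗ y ⊗ z ↦ x ⊗ (y β S(z))`. -/
noncomputable def θβ : H ⊗[k] (H ⊗[k] H) →ₗ[k] H ⊗[k] H :=
  TensorProduct.map LinearMap.id (mulInsert LinearMap.id (β (k := k)) antipode.toLinearMap)

/-- The linear map `x ⊗ y ⊗ z ↦ x ⊗ (S(y) α z)`. -/
noncomputable def θα : H ⊗[k] (H ⊗[k] H) →ₗ[k] H ⊗[k] H :=
  TensorProduct.map LinearMap.id (mulInsert antipode.toLinearMap (α (k := k)) LinearMap.id)

@[simp] theorem θβ_tmul (x y z : H) : θβ (k := k) (x ⊗ₜ[k] (y ⊗ₜ[k] z)) =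
    x ⊗ₜ[k] (y * β (k := k) * antipode (k := k) z) := rfl

@[simp] theorem θα_tmul (x y z : H) : θα (k := k) (x ⊗ₜ[k] (y ⊗ₜ[k] z)) =
    x ⊗ₜ[k] (antipode (k := k) y * α (k := k) * z) := rfl

theorem θβ_mul_left (w : H ⊗[k] H) (t : H) (z : H ⊗[k] (H ⊗[k] H)) :
    θβ (Algebra.TensorProduct.assoc k k k H H H (w ⊗ₜ[k] t) * z) =
      w * θβ z * (1 ⊗ₜ[k] antipode (k := k) t) := by
  induction w with
  | zero => simp
  | add x y hx hy => simp only [TensorProduct.add_tmul, map_add, add_mul, hx, hy]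
  | tmul x y =>
    induction z with
    | zero => simp
    | add x y hx hy => simp only [map_add, mul_add, add_mul, hx, hy]
    | tmul a z =>
      induction z with
      | zero => simp
      | add x y hx hy => simp only [TensorProduct.tmul_add, map_add, mul_add, add_mul, hx, hy]
      | tmul b c => simp [antipode_anti, mul_assoc]

theorem insert_β_mul (b c : H) (e : H ⊗[k] H) :
    mulInsert LinearMap.id (β (k := k)) antipode.toLinearMap ((b ⊗ₜ[k] c) * e) =
      b * mulInsert LinearMap.id (β (k := k)) antipode.toLinearMap e * antipode (k := k) c := by
  induction e with
  | zero => simp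
  | add x y hx hy => simp only [map_add, mul_add, add_mul, hx, hy]
  | tmul x y => simp [antipode_anti, mul_assoc]

theorem insert_α_mul (b c : H) (e : H ⊗[k] H) :
    mulInsert antipode.toLinearMap (α (k := k)) LinearMap.id (e * (b ⊗ₜ[k] c)) =
      antipode (k := k) b * mulInsert antipode.toLinearMap (α (k := k)) LinearMap.id e * c := by
  induction e with
  | zero => simp
  | add x y hx hy => simp only [map_add, mul_add, add_mul, hx, hy]
  | tmul x y => simp [antipode_anti, mul_assoc]

theorem θβ_mul_right (z : H ⊗[k] (H ⊗[k] H)) (d : H ⊗[k] H) :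
    θβ (z * Algebra.TensorProduct.map (AlgHom.id k H) comul d) =
      θβ z * ((Algebra.TensorProduct.rid k k H
        (Algebra.TensorProduct.map (AlgHom.id k H) counit d)) ⊗ₜ[k] 1) := by
  induction d with
  | zero => simp
  | add x y hx hy => simp only [map_add, mul_add, TensorProduct.add_tmul, hx, hy]
  | tmul d e =>
    induction z with
    | zero => simp
    | add x y hx hy => simp only [map_add, add_mul, hx, hy]
    | tmul a z =>
      induction z with
      | zero => simp
      | add x y hx hy => simp only [TensorProduct.tmul_add, map_add, add_mul, hx, hy]
      | tmul b c =>
        have := insert_β_mul (k := k) b c (comul e)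
        rw [mul_antipode] at this
        simp only [Algebra.TensorProduct.map_tmul, AlgHom.id_apply,
          Algebra.TensorProduct.tmul_mul_tmul, θβ, TensorProduct.map_tmul, this]
        simp [TensorProduct.smul_tmul]

theorem θα_mul_left (d : H ⊗[k] H) (z : H ⊗[k] (H ⊗[k] H)) :
    θα (Algebra.TensorProduct.map (AlgHom.id k H) comul d * z) =
      ((Algebra.TensorProduct.rid k k H
        (Algebra.TensorProduct.map (AlgHom.id k H) counit d)) ⊗ₜ[k] 1) * θα z := by
  induction d with
  | zero => simp
  | add x y hx hy => simp only [map_add, add_mul, TensorProduct.add_tmul, hx, hy]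
  | tmul d e =>
    induction z with
    | zero => simp
    | add x y hx hy => simp only [map_add, mul_add, hx, hy]
    | tmul a z =>
      induction z with
      | zero => simp
      | add x y hx hy => simp only [TensorProduct.tmul_add, map_add, mul_add, hx, hy]
      | tmul b c =>
        have := insert_α_mul (k := k) b c (comul e)
        rw [antipode_mul] at this
        simp only [Algebra.TensorProduct.map_tmul, AlgHom.id_apply,
          Algebra.TensorProduct.tmul_mul_tmul, θα, TensorProduct.map_tmul, this]
        simp [TensorProduct.smul_tmul]

/-- The element `φ⁽⁻¹⁾ ⊗ φ⁽⁻²⁾ β S(φ⁽⁻³⁾)`. -/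
noncomputable def curryElt : H ⊗[k] H := θβ ((φ (k := k) (H := H))⁻¹).val

/-- The element `φ⁽¹⁾ ⊗ S(φ⁽²⁾) α φ⁽³⁾`. -/
noncomputable def evElt : H ⊗[k] H := θα (φ (k := k) (H := H)).val

theorem curryElt_comul (h : H) :
    θβ (Algebra.TensorProduct.assoc k k k H H H
      (Algebra.TensorProduct.map comul (AlgHom.id k H) (comul (k := k) h)) * (φ⁻¹).val) =
      curryElt * (h ⊗ₜ[k] 1) := by
  have e := quasi_coassoc (k := k) h
  have e' : Algebra.TensorProduct.assoc k k k H H H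
      (Algebra.TensorProduct.map comul (AlgHom.id k H) (comul (k := k) h)) * (φ⁻¹).val =
      (φ⁻¹).val * Algebra.TensorProduct.map (AlgHom.id k H) comul (comul (k := k) h) := by
    rw [Units.eq_inv_mul_iff_mul_eq, ← mul_assoc, ← e, mul_assoc, Units.mul_inv, mul_one]
  rw [e', θβ_mul_right, comul_counit, curryElt]

theorem evElt_comul (h : H) :
    θα (φ.val * Algebra.TensorProduct.assoc k k k H H H
      (Algebra.TensorProduct.map comul (AlgHom.id k H) (comul (k := k) h))) =
      (h ⊗ₜ[k] 1) * evElt := by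
  rw [← quasi_coassoc, θα_mul_left, comul_counit, evElt]

end QuasiHopfAlgebra

namespace QuasiHopfAlgebra

variable {k : Type u} [CommRing k] {H : Type v} [Ring H] [Algebra k H]

theorem tensor_induction₃ {M N P : Type*} [AddCommGroup M] [Module k M] [AddCommGroup N]
    [Module k N] [AddCommGroup P] [Module k P] {p : M ⊗[k] (N ⊗[k] P) → Prop}
    (add : ∀ z w, p z → p w → p (z + w))
    (tmul : ∀ x y z, p (x ⊗ₜ[k] (y ⊗ₜ[k] z))) (z : M ⊗[k] (N ⊗[k] P)) : p z := by
  induction z with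
  | zero => simpa using tmul 0 0 0
  | add x y hx hy => exact add _ _ hx hy
  | tmul x y =>
    induction y with
    | zero => simpa using tmul x 0 0
    | add y y' hx hy => rw [TensorProduct.tmul_add]; exact add _ _ hx hy
    | tmul y t => exact tmul x y t

theorem tensor_induction₄ {M N P Q : Type*} [AddCommGroup M] [Module k M] [AddCommGroup N]
    [Module k N] [AddCommGroup P] [Module k P] [AddCommGroup Q] [Module k Q]
    {p : M ⊗[k] (N ⊗[k] (P ⊗[k] Q)) → Prop}
    (add : ∀ z w, p z → p w → p (z + w))
    (tmul : ∀ x y z t, p (x ⊗ₜ[k] (y ⊗ₜ[k] (z ⊗ₜ[k] t)))) (z : M ⊗[k] (N ⊗[k] (P ⊗[k] Q))) :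
    p z := by
  refine tensor_induction₃ add (fun x y z => ?_) z
  induction z with
  | zero => simpa using tmul x y 0 0
  | add z z' hx hy =>
    rw [TensorProduct.tmul_add, TensorProduct.tmul_add]; exact add _ _ hx hy
  | tmul z t => exact tmul x y z t

noncomputable instance addCommMonoid₄ : AddCommMonoid (H ⊗[k] (H ⊗[k] (H ⊗[k] H))) := TensorProduct.addCommMonoid
noncomputable instance mul₄ : Mul (H ⊗[k] (H ⊗[k] (H ⊗[k] H))) := Algebra.TensorProduct.instMul
noncomputable instance semiring₄ : Semiring (H ⊗[k] (H ⊗[k] (H ⊗[k] H))) := Algebra.TensorProduct.instSemiring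
noncomputable instance ring₄ : Ring (H ⊗[k] (H ⊗[k] (H ⊗[k] H))) := Algebra.TensorProduct.instRing
noncomputable instance algebra₄ : Algebra k (H ⊗[k] (H ⊗[k] (H ⊗[k] H))) := Algebra.TensorProduct.instAlgebra
noncomputable instance module₄ : Module k (H ⊗[k] (H ⊗[k] (H ⊗[k] H))) := TensorProduct.leftModule

theorem mul_add₄ (a b c : H ⊗[k] (H ⊗[k] (H ⊗[k] H))) : a * (b + c) = a * b + a * c :=
  Distrib.left_distrib a b c

theorem add_mul₄ (a b c : H ⊗[k] (H ⊗[k] (H ⊗[k] H))) : (a + b) * c = a * c + b * c :=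
  Distrib.right_distrib a b c

theorem mul_zero₄ (a : H ⊗[k] (H ⊗[k] (H ⊗[k] H))) : a * 0 = 0 :=
  MulZeroClass.mul_zero a

theorem zero_mul₄ (a : H ⊗[k] (H ⊗[k] (H ⊗[k] H))) : 0 * a = 0 :=
  MulZeroClass.zero_mul a

theorem ring_aux₁ {R : Type*} [Ring R] {A A' B CD E E' : R} (a : A' * A = 1) (b : E * E' = 1)
    (c : A * B = CD * E) : B * E' = A' * CD := by
  calc _ = A' * A * B * E' := by rw [a, one_mul]
    _ = A' * CD * (E * E') := by rw [mul_assoc A', c]; simp only [mul_assoc]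
    _ = _ := by rw [b, mul_one]

theorem ring_aux₂ {R : Type*} [Ring R] {A B C D E B' C' D' : R} (b : B * B' = 1)
    (hc : C' * C = 1) (d : D' * D = 1) (c : A * B = C * D * E) : E * B' = D' * (C' * A) := by
  calc _ = D' * (C' * C) * D * E * B' := by rw [hc, mul_one, d, one_mul]
    _ = D' * (C' * (C * D * E)) * B' := by simp only [mul_assoc]
    _ = D' * (C' * A) * (B * B') := by rw [← c]; simp only [mul_assoc]
    _ = _ := by rw [b, mul_one]

theorem map_inv_mul {A B : Type*} [Ring A] [Ring B] [Algebra k A] [Algebra k B]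
    (f : A →ₐ[k] B) (a : Aˣ) : f (a⁻¹).val * f a.val = 1 := by
  rw [← map_mul, Units.inv_mul, map_one]

theorem map_mul_inv {A B : Type*} [Ring A] [Ring B] [Algebra k A] [Algebra k B]
    (f : A →ₐ[k] B) (a : Aˣ) : f a.val * f (a⁻¹).val = 1 := by
  rw [← map_mul, Units.mul_inv, map_one]

variable [QuasiHopfAlgebra k H]

/-- The linear map `x ⊗ y ⊗ z ⊗ t ↦ x ⊗ (y β S(z) α t)`. -/
noncomputable def M₁ : H ⊗[k] (H ⊗[k] (H ⊗[k] H)) →ₗ[k] H ⊗[k] H :=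
  TensorProduct.map LinearMap.id (mulInsert LinearMap.id (β (k := k))
    (mulInsert antipode.toLinearMap (α (k := k)) LinearMap.id))

/-- The linear map `x ⊗ y ⊗ z ⊗ t ↦ x ⊗ (S(y) α z β S(t))`. -/
noncomputable def M₂ : H ⊗[k] (H ⊗[k] (H ⊗[k] H)) →ₗ[k] H ⊗[k] H :=
  TensorProduct.map LinearMap.id (mulInsert antipode.toLinearMap (α (k := k))
    (mulInsert LinearMap.id (β (k := k)) antipode.toLinearMap))

@[simp] theorem M₁_tmul (x y z t : H) : M₁ (k := k) (x ⊗ₜ[k] (y ⊗ₜ[k] (z ⊗ₜ[k] t))) =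
    x ⊗ₜ[k] (y * β (k := k) * (antipode (k := k) z * α (k := k) * t)) := rfl

@[simp] theorem M₂_tmul (x y z t : H) : M₂ (k := k) (x ⊗ₜ[k] (y ⊗ₜ[k] (z ⊗ₜ[k] t))) =
    x ⊗ₜ[k] (antipode (k := k) y * α (k := k) * (z * β (k := k) * antipode (k := k) t)) := rfl

theorem M₁_left (z : H ⊗[k] (H ⊗[k] H)) (w : H ⊗[k] (H ⊗[k] (H ⊗[k] H))) :
    M₁ (Algebra.TensorProduct.map (AlgHom.id k H)
      (Algebra.TensorProduct.map (AlgHom.id k H) comul) z * w) = counit₃ z * M₁ w := by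
  induction z using tensor_induction₃ with
  | add z z' h h' => simp only [map_add, add_mul, add_mul₄, h, h']
  | tmul x y t =>
  induction w using tensor_induction₄ with
  | add z z' h h' => simp only [map_add, mul_add, mul_add₄, h, h']
  | tmul a b c d =>
    have e : ∀ u : H ⊗[k] H, M₁ (k := k) ((x ⊗ₜ[k] (y ⊗ₜ[k] u)) * (a ⊗ₜ[k] (b ⊗ₜ[k] (c ⊗ₜ[k] d)))) =
        (x * a) ⊗ₜ[k] (y * b * β (k := k) * (antipode (k := k) c *
          mulInsert antipode.toLinearMap (α (k := k)) LinearMap.id u * d)) := by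
      intro u
      induction u with
      | zero => simp [zero_mul₄, mul_zero₄]
      | add u u' h h' =>
        simp only [TensorProduct.tmul_add, mul_add₄, map_add, add_mul, add_mul₄, mul_add, mul_add₄, h, h']
      | tmul u u' => simp [antipode_anti, mul_assoc]
    have := e (comul t)
    rw [antipode_mul] at this
    simp only [Algebra.TensorProduct.map_tmul, AlgHom.id_apply, this]
    simp [counit₃, TensorProduct.smul_tmul, mul_assoc]

theorem M₁_right (z : H ⊗[k] (H ⊗[k] H)) (w : H ⊗[k] (H ⊗[k] (H ⊗[k] H))) :
    M₁ (w * Algebra.TensorProduct.map (AlgHom.id k H)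
        ((Algebra.TensorProduct.assoc k k k H H H).toAlgHom.comp
          (Algebra.TensorProduct.map comul (AlgHom.id k H))) z) = M₁ w * counit₂ z := by
  induction z using tensor_induction₃ with
  | add z z' h h' => simp only [map_add, mul_add, mul_add₄, h, h']
  | tmul x y t =>
  induction w using tensor_induction₄ with
  | add z z' h h' => simp only [map_add, add_mul, add_mul₄, h, h']
  | tmul a b c d =>
    have e : ∀ u : H ⊗[k] H, M₁ (k := k) ((a ⊗ₜ[k] (b ⊗ₜ[k] (c ⊗ₜ[k] d))) *
        (x ⊗ₜ[k] (Algebra.TensorProduct.assoc k k k H H H (u ⊗ₜ[k] t)))) =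
        (a * x) ⊗ₜ[k] (b * mulInsert LinearMap.id (β (k := k)) antipode.toLinearMap u *
          (antipode (k := k) c * α (k := k) * d * t)) := by
      intro u
      induction u with
      | zero => simp [zero_mul₄, mul_zero₄]
      | add u u' h h' =>
        simp only [TensorProduct.tmul_add, mul_add₄, TensorProduct.add_tmul, map_add, add_mul, add_mul₄, mul_add, mul_add₄, h, h']
      | tmul u u' => simp [antipode_anti, mul_assoc]
    have := e (comul y)
    rw [mul_antipode] at this
    refine Eq.trans this ?_
    simp [counit₂, mul_assoc]

theorem M₂_left (z : H ⊗[k] (H ⊗[k] H)) (w : H ⊗[k] (H ⊗[k] (H ⊗[k] H))) :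
    M₂ (Algebra.TensorProduct.map (AlgHom.id k H)
        ((Algebra.TensorProduct.assoc k k k H H H).toAlgHom.comp
          (Algebra.TensorProduct.map comul (AlgHom.id k H))) z * w) =
      mulInsert Algebra.TensorProduct.includeLeft.toLinearMap (M₂ w)
        (Algebra.TensorProduct.includeRight.toLinearMap ∘ₗ antipode.toLinearMap) (counit₂ z) := by
  induction z using tensor_induction₃ with
  | add z z' h h' => simp only [map_add, add_mul, add_mul₄, h, h']
  | tmul x y t =>
  induction w using tensor_induction₄ with
  | add z z' h h' =>
    simp only [map_add, mul_add, mul_add₄, h, h']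
    simp [mulInsert, counit₂, mul_add, mul_add₄, add_mul, add_mul₄]
  | tmul a b c d =>
    have e : ∀ u : H ⊗[k] H, M₂ (k := k) (
        (x ⊗ₜ[k] (Algebra.TensorProduct.assoc k k k H H H (u ⊗ₜ[k] t))) *
        (a ⊗ₜ[k] (b ⊗ₜ[k] (c ⊗ₜ[k] d)))) =
        (x * a) ⊗ₜ[k] (antipode (k := k) b *
          mulInsert antipode.toLinearMap (α (k := k)) LinearMap.id u *
          (c * β (k := k) * antipode (k := k) d * antipode (k := k) t)) := by
      intro u
      induction u with
      | zero => simp [zero_mul₄, mul_zero₄]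
      | add u u' h h' =>
        simp only [TensorProduct.tmul_add, mul_add₄, TensorProduct.add_tmul, map_add, add_mul, add_mul₄, mul_add, mul_add₄, h, h']
      | tmul u u' => simp [antipode_anti, mul_assoc]
    have := e (comul y)
    rw [antipode_mul] at this
    refine Eq.trans this ?_
    simp [counit₂, mul_assoc]

theorem M₂_right (z : H ⊗[k] (H ⊗[k] H)) (w : H ⊗[k] (H ⊗[k] (H ⊗[k] H))) :
    M₂ (w * Algebra.TensorProduct.map (AlgHom.id k H)
      (Algebra.TensorProduct.map (AlgHom.id k H) comul) z) =
      mulInsert (Algebra.TensorProduct.includeRight.toLinearMap ∘ₗ antipode.toLinearMap) (M₂ w)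
        Algebra.TensorProduct.includeLeft.toLinearMap
        (Algebra.TensorProduct.comm k H H (counit₃ z)) := by
  induction z using tensor_induction₃ with
  | add z z' h h' => simp only [map_add, mul_add, mul_add₄, h, h']
  | tmul x y t =>
  induction w using tensor_induction₄ with
  | add z z' h h' =>
    simp only [map_add, add_mul, add_mul₄, h, h']
    simp [mulInsert, counit₃, mul_add, mul_add₄, add_mul, add_mul₄]
  | tmul a b c d =>
    have e : ∀ u : H ⊗[k] H, M₂ (k := k) ((a ⊗ₜ[k] (b ⊗ₜ[k] (c ⊗ₜ[k] d))) *
        (x ⊗ₜ[k] (y ⊗ₜ[k] u))) =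
        (a * x) ⊗ₜ[k] (antipode (k := k) y * antipode (k := k) b * α (k := k) * (c *
          mulInsert LinearMap.id (β (k := k)) antipode.toLinearMap u * antipode (k := k) d)) := by
      intro u
      induction u with
      | zero => simp [zero_mul₄, mul_zero₄]
      | add u u' h h' =>
        simp only [TensorProduct.tmul_add, mul_add₄, map_add, add_mul, add_mul₄, mul_add, mul_add₄, h, h']
      | tmul u u' => simp [antipode_anti, mul_assoc]
    have := e (comul t)
    rw [mul_antipode] at this
    simp only [Algebra.TensorProduct.map_tmul, AlgHom.id_apply, this]
    simp [counit₃, mul_assoc]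

theorem M₁_mid (z : H ⊗[k] (H ⊗[k] H)) (w : H ⊗[k] (H ⊗[k] H)) :
    M₁ (Algebra.TensorProduct.assoc k k k H H (H ⊗[k] H)
        (Algebra.TensorProduct.map comul (AlgHom.id k (H ⊗[k] H)) z) *
      Algebra.TensorProduct.map (AlgHom.id k H)
        (Algebra.TensorProduct.assoc k k k H H H).toAlgHom
        (Algebra.TensorProduct.assoc k k k H (H ⊗[k] H) H (w ⊗ₜ[k] (1 : H)))) =
      mulInsert comul.toLinearMap (θβ w) Algebra.TensorProduct.includeRight.toLinearMap
        (θα z) := by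
  induction z using tensor_induction₃ with
  | add z z' h h' => simp only [map_add, add_mul, add_mul₄, h, h']
  | tmul x y t =>
  induction w using tensor_induction₃ with
  | add z z' h h' =>
    simp only [map_add, TensorProduct.add_tmul, mul_add, mul_add₄, h, h']
    simp [mulInsert, mul_add, mul_add₄, add_mul, add_mul₄]
  | tmul a b c =>
    have e : ∀ u : H ⊗[k] H, M₁ (k := k) (Algebra.TensorProduct.assoc k k k H H (H ⊗[k] H)
        (u ⊗ₜ[k] (y ⊗ₜ[k] t)) * (a ⊗ₜ[k] (b ⊗ₜ[k] (c ⊗ₜ[k] 1)))) =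
        u * (a ⊗ₜ[k] (b * β (k := k) * antipode (k := k) c)) *
        (1 ⊗ₜ[k] (antipode (k := k) y * α (k := k) * t)) := by
      intro u
      induction u with
      | zero => simp [zero_mul₄, mul_zero₄]
      | add u u' h h' =>
        simp only [TensorProduct.add_tmul, map_add, add_mul, add_mul₄, h, h']
      | tmul u u' => simp [antipode_anti, mul_assoc]
    exact e (comul x)

theorem M₂_mid (z : H ⊗[k] (H ⊗[k] H)) (w : H ⊗[k] (H ⊗[k] H)) :
    M₂ (Algebra.TensorProduct.map (AlgHom.id k H)
        (Algebra.TensorProduct.assoc k k k H H H).toAlgHom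
        (Algebra.TensorProduct.assoc k k k H (H ⊗[k] H) H (w ⊗ₜ[k] (1 : H))) *
      Algebra.TensorProduct.assoc k k k H H (H ⊗[k] H)
        (Algebra.TensorProduct.map comul (AlgHom.id k (H ⊗[k] H)) z)) =
      θα (w * Algebra.TensorProduct.assoc k k k H H H
        (Algebra.TensorProduct.map comul (AlgHom.id k H) (θβ z))) := by
  induction z using tensor_induction₃ with
  | add z z' h h' => simp only [map_add, mul_add, mul_add₄, h, h']
  | tmul x y t =>
  induction w using tensor_induction₃ with
  | add z z' h h' =>
    simp only [map_add, TensorProduct.add_tmul, add_mul, add_mul₄, h, h']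
  | tmul a b c =>
    have e : ∀ u : H ⊗[k] H, M₂ (k := k) ((a ⊗ₜ[k] (b ⊗ₜ[k] (c ⊗ₜ[k] 1))) *
        Algebra.TensorProduct.assoc k k k H H (H ⊗[k] H) (u ⊗ₜ[k] (y ⊗ₜ[k] t))) =
        θα ((a ⊗ₜ[k] (b ⊗ₜ[k] c)) * Algebra.TensorProduct.assoc k k k H H H
          (u ⊗ₜ[k] (y * β (k := k) * antipode (k := k) t))) := by
      intro u
      induction u with
      | zero => simp [zero_mul₄, mul_zero₄]
      | add u u' h h' =>
        simp only [TensorProduct.add_tmul, map_add, mul_add, mul_add₄, h, h']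
      | tmul u u' => simp [antipode_anti, mul_assoc]
    exact e (comul x)

theorem exists_algHom_tmul_one : ∃ E : H ⊗[k] (H ⊗[k] H) →ₐ[k] H ⊗[k] (H ⊗[k] (H ⊗[k] H)),
    ∀ z, Algebra.TensorProduct.map (AlgHom.id k H)
        (Algebra.TensorProduct.assoc k k k H H H).toAlgHom
        (Algebra.TensorProduct.assoc k k k H (H ⊗[k] H) H (z ⊗ₜ[k] (1 : H))) = E z :=
  ⟨((Algebra.TensorProduct.map (AlgHom.id k H)
        (Algebra.TensorProduct.assoc k k k H H H).toAlgHom).comp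
        (Algebra.TensorProduct.assoc k k k H (H ⊗[k] H) H).toAlgHom).comp
        Algebra.TensorProduct.includeLeft, fun _ => rfl⟩

theorem exists_algHom_comul_left :
    ∃ E : H ⊗[k] (H ⊗[k] H) →ₐ[k] H ⊗[k] (H ⊗[k] (H ⊗[k] H)),
    ∀ z, Algebra.TensorProduct.assoc k k k H H (H ⊗[k] H)
        (Algebra.TensorProduct.map comul (AlgHom.id k (H ⊗[k] H)) z) = E z :=
  ⟨(Algebra.TensorProduct.assoc k k k H H (H ⊗[k] H)).toAlgHom.comp
        (Algebra.TensorProduct.map comul (AlgHom.id k (H ⊗[k] H))), fun _ => rfl⟩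

theorem exists_algHom_one_tmul : ∃ E : H ⊗[k] (H ⊗[k] H) →ₐ[k] H ⊗[k] (H ⊗[k] (H ⊗[k] H)),
    ∀ z, (1 : H) ⊗ₜ[k] z = E z :=
  ⟨Algebra.TensorProduct.includeRight, fun _ => rfl⟩

set_option maxHeartbeats 2000000 in
theorem uncurry_curry_elt : mulInsert comul.toLinearMap (curryElt (k := k) (H := H))
    Algebra.TensorProduct.includeRight.toLinearMap evElt = 1 := by
  rw [curryElt, evElt, ← M₁_mid]
  have c := cocycle (k := k) (H := H)
  obtain ⟨E, hE⟩ := exists_algHom_tmul_one (k := k) (H := H)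
  rw [hE] at c ⊢
  rw [ring_aux₁ (map_inv_mul _ _) (map_mul_inv _ _) c]
  rw [M₁_left, M₁_right, counit₂_φ, map_inv_eq_one _ _ counit₃_φ, one_mul, mul_one]
  change (1 : H) ⊗ₜ[k] _ = _
  rw [antipode_φ, Algebra.TensorProduct.one_def]

set_option maxHeartbeats 2000000 in
theorem curry_uncurry_elt : θα ((φ (k := k) (H := H)).val *
    Algebra.TensorProduct.assoc k k k H H H
      (Algebra.TensorProduct.map comul (AlgHom.id k H) curryElt)) = 1 := by
  rw [curryElt, ← M₂_mid]
  have c := cocycle (k := k) (H := H)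
  obtain ⟨B, hB⟩ := exists_algHom_comul_left (k := k) (H := H)
  obtain ⟨C, hC⟩ := exists_algHom_one_tmul (k := k) (H := H)
  have m : M₂ ((1 : H) ⊗ₜ[k] ((φ (k := k) (H := H))⁻¹).val) = 1 := by
    change (1 : H) ⊗ₜ[k] _ = _
    rw [antipode_φ_inv, Algebra.TensorProduct.one_def]
  rw [hC] at m
  rw [hB, hC] at c
  rw [hB]
  rw [ring_aux₂ (map_mul_inv _ _) (map_inv_mul _ _) (map_inv_mul _ _) c]
  rw [M₂_left, M₂_right, counit₃_φ, map_inv_eq_one (counit₂ (k := k) (H := H)) _ counit₂_φ,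
    map_one (Algebra.TensorProduct.comm k H H),
    Algebra.TensorProduct.one_def, mulInsert_tmul, mulInsert_tmul, m]
  simp [antipode_one]

end QuasiHopfAlgebra

/-- A monoidal category in which every functor `- ⊗ W` has a right adjoint `hom(W, -)`,
functorially in `W`. -/
class RightClosed (C : Type*) [Category* C] [MonoidalCategory C] where
  ihom : Cᵒᵖ ⥤ C ⥤ C
  adj : (curriedTensor C).flip ⊣₂ ihom

namespace HModule

section Closed

variable {k : Type u} [CommRing k] {H : Type v} [Ring H] [Algebra k H]

/-- The action `x ▷ L = (x ▷ ·) ∘ L` of `H` on `Hom(W, X)`. -/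
noncomputable def postAct (W X : HModule k H) : H →ₐ[k] Module.End k (W →ₗ[k] X) :=
  AlgHom.ofLinearMap ((LinearMap.llcomp k W X X) ∘ₗ X.act.toLinearMap)
    (by ext; simp) (fun x y => by ext; simp)

variable [QuasiHopfAlgebra k H]

open QuasiHopfAlgebra

/-- The action `y ▷ L = L ∘ (S(y) ▷ ·)` of `H` on `Hom(W, X)`. -/
noncomputable def preAct (W X : HModule k H) : H →ₐ[k] Module.End k (W →ₗ[k] X) :=
  AlgHom.ofLinearMap ((LinearMap.llcomp k W W X).flip ∘ₗ W.act.toLinearMap ∘ₗ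
      antipode.toLinearMap)
    (by ext; simp [antipode_one]) (fun x y => by ext; simp [antipode_anti])

/-- The action `x ⊗ y ▷ L = (x ▷ ·) ∘ L ∘ (S(y) ▷ ·)` of `H ⊗ H` on `Hom(W, X)`. -/
noncomputable def homAct (W X : HModule k H) : H ⊗[k] H →ₐ[k] Module.End k (W →ₗ[k] X) :=
  Algebra.TensorProduct.lift (postAct W X) (preAct W X) fun x y => by
    change _ * _ = _ * _
    ext
    rfl

theorem homAct_tmul (W X : HModule k H) (x y : H) (L : W →ₗ[k] X) :
    homAct W X (x ⊗ₜ[k] y) L = X.act x ∘ₗ L ∘ₗ W.act (antipode (k := k) y) := rfl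

/-- The internal hom: `k`-linear maps with `h ▷ L = (h₁ ▷ ·) ∘ L ∘ (S(h₂) ▷ ·)`. -/
@[simps carrier addCommGroup module act]
noncomputable def ihomObj (W X : HModule k H) : HModule k H where
  carrier := W →ₗ[k] X
  act := (homAct W X).comp comul

theorem homAct_naturality {W W' X X' : HModule k H} (f : W' ⟶ W) (g : X ⟶ X')
    (e : H ⊗[k] H) (L : W →ₗ[k] X) :
    lin g ∘ₗ homAct W X e L ∘ₗ lin f = homAct W' X' e (lin g ∘ₗ L ∘ₗ lin f) := by
  induction e with
  | zero => simp
  | add x y hx hy => 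
    simp only [map_add, LinearMap.add_apply, LinearMap.comp_add, LinearMap.add_comp, hx, hy]
  | tmul x y =>
    ext w
    simp [homAct_tmul, lin_act]

/-- `L ↦ g ∘ L ∘ f`. -/
noncomputable def ihomMap {W W' X X' : HModule k H} (f : W' ⟶ W) (g : X ⟶ X') :
    ihomObj W X ⟶ ihomObj W' X' where
  lin := LinearMap.llcomp k W' X X' (lin g) ∘ₗ (LinearMap.llcomp k W' W X).flip (lin f)
  equivariant h := by
    ext L : 1
    exact homAct_naturality f g (comul h) L

theorem lin_ihomMap {W W' X X' : HModule k H} (f : W' ⟶ W) (g : X ⟶ X') (L : W →ₗ[k] X) :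
    lin (ihomMap f g) L = lin g ∘ₗ L ∘ₗ lin f := rfl

/-- The internal hom functor. -/
@[simps]
noncomputable def ihomFunctor : (HModule k H)ᵒᵖ ⥤ HModule k H ⥤ HModule k H where
  obj W :=
    { obj := fun X => ihomObj W.unop X
      map := fun g => ihomMap (𝟙 W.unop) g
      map_id := fun _ => rfl
      map_comp := fun _ _ => rfl }
  map f := { app := fun X => ihomMap f.unop (𝟙 X)
             naturality := fun _ _ _ => rfl }
  map_id _ := rfl
  map_comp _ _ := rfl

/-- The linear map underlying a morphism out of a tensor product. -/
noncomputable def tlin {V W X : HModule k H} (f : V ⊗ W ⟶ X) : V ⊗[k] W →ₗ[k] X := lin f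

theorem tlin_act {V W X : HModule k H} (f : V ⊗ W ⟶ X) (h : H) (z : V ⊗[k] W) :
    X.act h (tlin f z) = tlin f (act₂ V W (comul h) z) := (lin_act f h z).symm

/-- The linear map underlying a morphism into an internal hom. -/
noncomputable def hlin {V W X : HModule k H} (g : V ⟶ ihomObj W X) : V →ₗ[k] (W →ₗ[k] X) :=
  lin g

theorem hlin_act {V W X : HModule k H} (g : V ⟶ ihomObj W X) (h : H) (v : V) :
    hlin g (V.act h v) = homAct W X (comul h) (hlin g v) := lin_act g h v

theorem curry_homAct {V W X : HModule k H} (f : V ⊗ W ⟶ X) (e : H ⊗[k] H) (v : V) (w : W) :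
    homAct W X e (TensorProduct.curry (tlin f ∘ₗ act₂ V W curryElt) v) w =
      tlin f (act₂ V W (θβ (Algebra.TensorProduct.assoc k k k H H H
        (Algebra.TensorProduct.map comul (AlgHom.id k H) e) * (φ⁻¹).val)) (v ⊗ₜ[k] w)) := by
  induction e with
  | zero => simp
  | add x y hx hy => simp only [map_add, add_mul, LinearMap.add_apply, hx, hy]
  | tmul x y =>
    rw [Algebra.TensorProduct.map_tmul, θβ_mul_left, map_mul, map_mul, homAct_tmul]
    refine (tlin_act f x _).trans ?_
    simp [curryElt]

/-- Currying: `v ↦ f ((φ⁽⁻¹⁾ ▷ v) ⊗ (φ⁽⁻²⁾ β S(φ⁽⁻³⁾) ▷ ·))`. -/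
noncomputable def curry {V W X : HModule k H} (f : V ⊗ W ⟶ X) : V ⟶ ihomObj W X where
  lin := TensorProduct.curry (tlin f ∘ₗ act₂ V W curryElt)
  equivariant h := by
    refine LinearMap.ext fun v => LinearMap.ext fun w => ?_
    refine Eq.trans ?_ (curry_homAct f (comul h) v w).symm
    rw [curryElt_comul, map_mul]
    simp
    rfl

/-- Evaluation of linear maps. -/
noncomputable def evLin (W X : HModule k H) : (W →ₗ[k] X) ⊗[k] W →ₗ[k] X :=
  TensorProduct.lift LinearMap.id

theorem evLin_θα (W X : HModule k H) (z : H ⊗[k] (H ⊗[k] H)) (e : H ⊗[k] H) (t : H)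
    (L : W →ₗ[k] X) (w : W) :
    evLin W X (pairAct (postAct W X) W.act
      (θα (z * Algebra.TensorProduct.assoc k k k H H H (e ⊗ₜ[k] t))) (L ⊗ₜ[k] w)) =
    evLin W X (pairAct (postAct W X) W.act (θα z) (homAct W X e L ⊗ₜ[k] W.act t w)) := by
  induction z using tensor_induction₃ with
  | add x y hx hy => simp only [map_add, add_mul, LinearMap.add_apply, hx, hy]
  | tmul a b c =>
    induction e with
    | zero => simp
    | add x y hx hy =>
      simp only [map_add, mul_add, LinearMap.add_apply, hx, hy, TensorProduct.add_tmul]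
    | tmul x y =>
      simp [evLin, postAct, homAct_tmul, antipode_anti]

theorem evLin_act (W X : HModule k H) (h : H) (e : H ⊗[k] H) (z : (W →ₗ[k] X) ⊗[k] W) :
    evLin W X (pairAct (postAct W X) W.act ((h ⊗ₜ[k] 1) * e) z) =
      X.act h (evLin W X (pairAct (postAct W X) W.act e z)) := by
  rw [map_mul, Module.End.mul_apply]
  generalize pairAct (postAct W X) W.act e z = y
  induction y with
  | zero => simp
  | add x y hx hy => simp only [map_add, hx, hy]
  | tmul x y => simp [evLin, postAct]

/-- Uncurrying: `v ⊗ w ↦ φ⁽¹⁾ ▷ (g(v) (S(φ⁽²⁾) α φ⁽³⁾ ▷ w))`. -/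
noncomputable def uncurry {V W X : HModule k H} (g : V ⟶ ihomObj W X) : V ⊗ W ⟶ X where
  lin := evLin W X ∘ₗ pairAct (postAct W X) W.act evElt ∘ₗ
    TensorProduct.map (hlin g) LinearMap.id
  equivariant h := by
    apply TensorProduct.ext'
    intro v w
    have key : ∀ d : H ⊗[k] H, evLin W X (pairAct (postAct W X) W.act evElt
        (TensorProduct.map (hlin g) LinearMap.id (act₂ V W d (v ⊗ₜ[k] w)))) =
        evLin W X (pairAct (postAct W X) W.act (θα (φ.val * Algebra.TensorProduct.assoc k k k H H H
          (Algebra.TensorProduct.map comul (AlgHom.id k H) d))) (hlin g v ⊗ₜ[k] w)) := by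
      intro d
      induction d with
      | zero => simp
      | add x y hx hy => simp only [map_add, mul_add, LinearMap.add_apply, hx, hy]
      | tmul x y =>
        refine Eq.trans ?_ (evLin_θα W X φ.val (comul x) y (hlin g v) w).symm
        rw [pairAct_tmul, TensorProduct.map_tmul, TensorProduct.map_tmul, hlin_act]
        rfl
    have e := key (comul h)
    rw [evElt_comul, evLin_act] at e
    exact e

theorem tlin_uncurry_tmul {V W X : HModule k H} (g : V ⟶ ihomObj W X) (v : V) (w : W) :
    tlin (uncurry g) (v ⊗ₜ[k] w) =
      evLin W X (pairAct (postAct W X) W.act evElt (hlin g v ⊗ₜ[k] w)) := rfl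

theorem hlin_curry_apply {V W X : HModule k H} (f : V ⊗ W ⟶ X) (v : V) (w : W) :
    hlin (curry f) v w = tlin f (act₂ V W curryElt (v ⊗ₜ[k] w)) := rfl

theorem uncurry_curry {V W X : HModule k H} (f : V ⊗ W ⟶ X) : uncurry (curry f) = f := by
  apply hom_ext
  apply TensorProduct.ext'
  intro v w
  have key : ∀ d : H ⊗[k] H, evLin W X (pairAct (postAct W X) W.act d
      (hlin (curry f) v ⊗ₜ[k] w)) = tlin f (act₂ V W
        (mulInsert comul.toLinearMap curryElt Algebra.TensorProduct.includeRight.toLinearMap d)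
        (v ⊗ₜ[k] w)) := by
    intro d
    induction d with
    | zero => simp
    | add x y hx hy => simp only [map_add, LinearMap.add_apply, hx, hy]
    | tmul x y =>
      have q := lin_act f x (act₂ V W curryElt (v ⊗ₜ[k] W.act y w))
      rw [mulInsert_tmul, map_mul, map_mul]
      change X.act x (lin f (act₂ V W curryElt (v ⊗ₜ[k] W.act y w))) =
        tlin f (act₂ V W (comul x) (act₂ V W curryElt _))
      rw [← q]
      simp
      rfl
  refine (key evElt).trans ?_
  rw [uncurry_curry_elt, map_one]
  rfl

theorem curry_uncurry {V W X : HModule k H} (g : V ⟶ ihomObj W X) : curry (uncurry g) = g := by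
  apply hom_ext
  refine LinearMap.ext fun v => LinearMap.ext fun w => ?_
  have key : ∀ d : H ⊗[k] H, tlin (uncurry g) (act₂ V W d (v ⊗ₜ[k] w)) =
        evLin W X (pairAct (postAct W X) W.act (θα (φ.val * Algebra.TensorProduct.assoc k k k H H H
          (Algebra.TensorProduct.map comul (AlgHom.id k H) d))) (hlin g v ⊗ₜ[k] w)) := by
    intro d
    induction d with
    | zero => simp
    | add x y hx hy => simp only [map_add, mul_add, LinearMap.add_apply, hx, hy]
    | tmul x y =>
      refine Eq.trans ?_ (evLin_θα W X φ.val (comul x) y (hlin g v) w).symm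
      rw [pairAct_tmul, TensorProduct.map_tmul, tlin_uncurry_tmul, hlin_act]
      rfl
  refine (key curryElt).trans ?_
  rw [curry_uncurry_elt, map_one]
  rfl

/-- The adjunction between `- ⊗ W` and `hom(W, -)`. -/
noncomputable def adj (W : HModule k H) :
    (curriedTensor (HModule k H)).flip.obj W ⊣ ihomFunctor.obj (Opposite.op W) :=
  Adjunction.mkOfHomEquiv
    { homEquiv := fun V X =>
        { toFun := fun f => curry f
          invFun := fun g => uncurry g
          left_inv := uncurry_curry
          right_inv := curry_uncurry }
      homEquiv_naturality_left_symm := fun f g => by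
        apply hom_ext
        apply TensorProduct.ext'
        intro v w
        rfl
      homEquiv_naturality_right := fun f g => rfl }

noncomputable instance : RightClosed (HModule k H) where
  ihom := ihomFunctor
  adj := ParametrizedAdjunction.mk' adj fun {W W'} f {V X} g => by
    change curry ((V ◁ f) ≫ g) = curry g ≫ ihomMap f (𝟙 X)
    apply hom_ext
    refine LinearMap.ext fun v => LinearMap.ext fun w => ?_
    have n := pairAct_naturality (p := LinearMap.id) (q := lin f) (f' := V.act) (g' := W'.act)
      (fun _ => rfl) f.equivariant (curryElt (k := k) (H := H))
    exact congrArg (tlin g) (LinearMap.congr_fun n (v ⊗ₜ[k] w))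

end Closed

end HModule

namespace HModule

section Limits

variable {k : Type u} [CommRing k] {H : Type v} [Ring H] [Algebra k H]

theorem range_le_comap {V W : HModule k H} (f g : V ⟶ W) (h : H) :
    LinearMap.range (lin f - lin g) ≤ (LinearMap.range (lin f - lin g)).comap (W.act h) := by
  rintro _ ⟨v, rfl⟩
  exact ⟨V.act h v, by simp [lin_act]⟩

/-- The quotient of `W` by the image of `f - g`. -/
def coeqObj {V W : HModule k H} (f g : V ⟶ W) : HModule k H where
  carrier := W ⧸ LinearMap.range (lin f - lin g)
  act :=
    { toFun := fun h => Submodule.mapQ _ _ (W.act h) (range_le_comap f g h)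
      map_one' := by ext; simp
      map_mul' := fun x y => by ext; simp
      map_zero' := by ext; simp
      map_add' := fun x y => by ext; simp
      commutes' := fun r => by ext; simp [Algebra.algebraMap_eq_smul_one] }

/-- The quotient map. -/
def coeqπ {V W : HModule k H} (f g : V ⟶ W) : W ⟶ coeqObj f g where
  lin := Submodule.mkQ _
  equivariant _ := rfl

theorem coeq_condition {V W : HModule k H} (f g : V ⟶ W) :
    f ≫ coeqπ f g = g ≫ coeqπ f g := by
  apply hom_ext
  ext v
  exact (Submodule.Quotient.eq _).2 ⟨v, rfl⟩

/-- The universal property of the quotient. -/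
def coeqDesc {V W X : HModule k H} (f g : V ⟶ W) (t : W ⟶ X) (e : f ≫ t = g ≫ t) :
    coeqObj f g ⟶ X where
  lin := Submodule.liftQ _ (lin t) (by
    rintro _ ⟨v, rfl⟩
    have := LinearMap.congr_fun (congrArg lin e) v
    simp at this
    simp [this])
  equivariant h := by
    apply Submodule.linearMap_qext
    exact t.equivariant h

instance : HasCoequalizers (HModule k H) :=
  @hasCoequalizers_of_hasColimit_parallelPair _ _ fun {V W f g} =>
  ⟨⟨Cofork.ofπ (coeqπ f g) (coeq_condition f g), Cofork.IsColimit.mk _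
    (fun s => coeqDesc f g s.π s.condition) (fun s => rfl) (fun s m hm => by
      apply hom_ext
      apply Submodule.linearMap_qext
      exact congrArg lin hm)⟩⟩

/-- The submodule of `V` on which `f` and `g` agree. -/
def eqObj {V W : HModule k H} (f g : V ⟶ W) : HModule k H where
  carrier := LinearMap.eqLocus (lin f) (lin g)
  act :=
    { toFun := fun h => (V.act h).restrict fun v hv => by
        have : lin f v = lin g v := hv
        change lin f _ = lin g _
        rw [lin_act, lin_act, this]
      map_one' := by ext; simp
      map_mul' := fun x y => by ext; simp
      map_zero' := by ext; simp
      map_add' := fun x y => by ext; simp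
      commutes' := fun r => by ext; simp [Algebra.algebraMap_eq_smul_one] }

/-- The inclusion. -/
def eqι {V W : HModule k H} (f g : V ⟶ W) : eqObj f g ⟶ V where
  lin := Submodule.subtype _
  equivariant _ := rfl

theorem eq_condition {V W : HModule k H} (f g : V ⟶ W) :
    eqι f g ≫ f = eqι f g ≫ g := by
  apply hom_ext
  ext v
  exact v.2

/-- The universal property of the submodule. -/
def eqLift {V W X : HModule k H} (f g : V ⟶ W) (t : X ⟶ V) (e : t ≫ f = t ≫ g) :
    X ⟶ eqObj f g where
  lin := (lin t).codRestrict _ fun x => LinearMap.congr_fun (congrArg lin e) x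
  equivariant h := by
    refine LinearMap.ext fun x => Subtype.ext ?_
    exact lin_act t h x

instance : HasEqualizers (HModule k H) :=
  @hasEqualizers_of_hasLimit_parallelPair _ _ fun {V W f g} =>
  ⟨⟨Fork.ofι (eqι f g) (eq_condition f g), Fork.IsLimit.mk _
    (fun s => eqLift f g s.ι s.condition) (fun s => rfl) (fun s m hm => by
      apply hom_ext
      refine LinearMap.ext fun x => Subtype.ext ?_
      exact LinearMap.congr_fun (congrArg lin hm) x)⟩⟩

end Limits

end HModule

section Closed

variable {C : Type*} [Category* C] [MonoidalCategory C] [RightClosed C]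

instance tensorRight_preservesColimits (X : C) :
    PreservesColimitsOfSize.{0, 0} (tensorRight X) :=
  ((RightClosed.adj (C := C)).adj X).leftAdjoint_preservesColimits

instance tensorLeft_preservesColimits [BraidedCategory C] (X : C) :
    PreservesColimitsOfSize.{0, 0} (tensorLeft X) :=
  preservesColimits_of_natIso (BraidedCategory.tensorLeftIsoTensorRight X).symm

end Closed

section Generic

open MonObj

variable {C : Type*} [Category* C] [MonoidalCategory C]

namespace RightClosed

variable [RightClosed C]

/-- The internal hom-object `hom(W, X)`. -/
abbrev rhom (W X : C) : C := (ihom.obj (Opposite.op W)).obj X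

/-- The bijection `ζ : Hom(V ⊗ W, X) ≃ Hom(V, hom(W, X))`. -/
def ζ {V W X : C} : (V ⊗ W ⟶ X) ≃ (V ⟶ rhom W X) := (adj.adj W).homEquiv V X

theorem ζ_naturality_left {V V' W X : C} (f : V' ⟶ V) (g : V ⊗ W ⟶ X) :
    ζ (f ▷ W ≫ g) = f ≫ ζ g :=
  (adj.adj W).homEquiv_naturality_left f g

theorem ζ_naturality_right {V W X X' : C} (f : V ⊗ W ⟶ X) (g : X ⟶ X') :
    ζ (f ≫ g) = ζ f ≫ (ihom.obj (Opposite.op W)).map g :=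
  (adj.adj W).homEquiv_naturality_right f g

theorem ζ_naturality_mid {V W W' X : C} (f : W' ⟶ W) (g : V ⊗ W ⟶ X) :
    ζ (V ◁ f ≫ g) = ζ g ≫ (ihom.map f.op).app X :=
  adj.homEquiv_naturality_one f g

/-- The evaluation `hom(V, W) ⊗ V ⟶ W`. -/
def ev (V W : C) : rhom V W ⊗ V ⟶ W := ζ.symm (𝟙 _)

theorem ζ_symm {V W X : C} (g : V ⟶ rhom W X) : ζ.symm g = g ▷ W ≫ ev W X := by
  rw [Equiv.symm_apply_eq, ζ_naturality_left, ev, Equiv.apply_symm_apply, Category.comp_id]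

theorem ζ_ev {V W X : C} (f : V ⊗ W ⟶ X) : ζ f ▷ W ≫ ev W X = f := by
  rw [← ζ_symm, Equiv.symm_apply_apply]

theorem ζ_ev_assoc {V W X Y : C} (f : V ⊗ W ⟶ X) (g : X ⟶ Y) :
    ζ f ▷ W ≫ ev W X ≫ g = f ≫ g := by
  rw [← Category.assoc, ζ_ev]

theorem rhom_ext {V W X : C} {f g : V ⟶ rhom W X} (h : f ▷ W ≫ ev W X = g ▷ W ≫ ev W X) :
    f = g := by
  rw [← ζ_symm, ← ζ_symm] at h
  exact ζ.symm.injective h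

theorem ihom_map_ev {W W' X X' : C} (f : W' ⟶ W) (g : X ⟶ X') :
    ((ihom.obj (Opposite.op W)).map g ≫ (ihom.map f.op).app X') ▷ W' ≫ ev W' X' =
      _ ◁ f ≫ ev W X ≫ g := by
  have h : (ihom.obj (Opposite.op W)).map g ≫ (ihom.map f.op).app X' =
      ζ (_ ◁ f ≫ ev W X ≫ g) := by
    rw [ζ_naturality_mid, ζ_naturality_right, ev, Equiv.apply_symm_apply, Category.id_comp]
  rw [h, ζ_ev]

/-- The internal composition `hom(W, X) ⊗ hom(V, W) ⟶ hom(V, X)`. -/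
def bullet (V W X : C) : rhom W X ⊗ rhom V W ⟶ rhom V X :=
  ζ ((α_ _ _ _).hom ≫ rhom W X ◁ ev V W ≫ ev W X)

end RightClosed

namespace Bimod

open RightClosed

variable [RightClosed C] {A : Mon C}

/-- The morphism `A ⟶ hom(V, V)` corresponding to the left `A`-action. -/
def lhat (V : Bimod A A) : A.X ⟶ rhom V.X V.X := ζ V.actLeft

/-- The left `A`-action on `hom(V, W)`. -/
def homActLeft (V W : Bimod A A) : A.X ⊗ rhom V.X W.X ⟶ rhom V.X W.X :=
  lhat W ▷ _ ≫ bullet V.X W.X W.X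

/-- The right `A`-action on `hom(V, W)`. -/
def homActRight (V W : Bimod A A) : rhom V.X W.X ⊗ A.X ⟶ rhom V.X W.X :=
  _ ◁ lhat V ≫ bullet V.X V.X W.X

theorem homActLeft_ev (V W : Bimod A A) : homActLeft V W ▷ V.X ≫ ev V.X W.X =
    (α_ _ _ _).hom ≫ A.X ◁ ev V.X W.X ≫ W.actLeft := by
  simp only [homActLeft, bullet, comp_whiskerRight, Category.assoc, ζ_ev]
  rw [associator_naturality_left_assoc, ← whisker_exchange_assoc, lhat, ζ_ev]

theorem homActRight_ev (V W : Bimod A A) : homActRight V W ▷ V.X ≫ ev V.X W.X =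
    (α_ _ _ _).hom ≫ _ ◁ V.actLeft ≫ ev V.X W.X := by
  simp only [homActRight, bullet, comp_whiskerRight, Category.assoc, ζ_ev]
  rw [associator_naturality_middle_assoc, ← whiskerLeft_comp_assoc, lhat, ζ_ev]

/-- The `A`-bimodule structure on the internal hom-object `hom(V, W)`. -/
@[simps]
def homBimod (V W : Bimod A A) : Bimod A A where
  X := rhom V.X W.X
  actLeft := homActLeft V W
  actRight := homActRight V W
  one_actLeft := rhom_ext <| by
    rw [comp_whiskerRight, Category.assoc, homActLeft_ev, associator_naturality_left_assoc,
      ← whisker_exchange_assoc, one_actLeft, leftUnitor_naturality, leftUnitor_whiskerRight,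
      Category.assoc]
  left_assoc := rhom_ext <| by
    simp only [comp_whiskerRight, Category.assoc, homActLeft_ev]
    rw [associator_naturality_left_assoc, ← whisker_exchange_assoc, left_assoc,
      associator_naturality_middle_assoc]
    simp only [← whiskerLeft_comp_assoc, homActLeft_ev, Category.assoc]
    simp
  actRight_one := rhom_ext <| by
    rw [comp_whiskerRight, Category.assoc, homActRight_ev, associator_naturality_middle_assoc,
      ← whiskerLeft_comp_assoc, one_actLeft]
    simp
  right_assoc := rhom_ext <| by
    simp only [comp_whiskerRight, Category.assoc, homActRight_ev]
    rw [associator_naturality_middle_assoc, associator_naturality_left_assoc,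
      ← whisker_exchange_assoc, homActRight_ev, ← whiskerLeft_comp_assoc, left_assoc]
    simp
  middle_assoc := rhom_ext <| by
    simp only [comp_whiskerRight, Category.assoc, homActRight_ev]
    rw [associator_naturality_left_assoc, ← whisker_exchange_assoc]
    have e := congrArg (fun f => A.X ◁ f ≫ W.actLeft) (homActRight_ev V W)
    simp only [whiskerLeft_comp, Category.assoc] at e
    rw [homActLeft_ev, whisker_assoc]
    simp only [Category.assoc, Iso.inv_hom_id_assoc, e]
    simp

/-- The bimodule structure on a subobject that is stable under both actions. -/
@[simps]
def subBimod {V : Bimod A A} {E : C} (i : E ⟶ V.X) (_ : Mono i) (l : A.X ⊗ E ⟶ E) (r : E ⊗ A.X ⟶ E)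
    (hl : l ≫ i = A.X ◁ i ≫ V.actLeft) (hr : r ≫ i = i ▷ A.X ≫ V.actRight) : Bimod A A where
  X := E
  actLeft := l
  actRight := r
  one_actLeft := by
    rw [← cancel_mono i, Category.assoc, hl, ← whisker_exchange_assoc, one_actLeft,
      leftUnitor_naturality]
  left_assoc := by
    rw [← cancel_mono i]
    simp only [Category.assoc, hl]
    rw [← whiskerLeft_comp_assoc, hl, ← whisker_exchange_assoc, left_assoc]
    simp
  actRight_one := by
    rw [← cancel_mono i, Category.assoc, hr, whisker_exchange_assoc, actRight_one,
      rightUnitor_naturality]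
  right_assoc := by
    rw [← cancel_mono i]
    simp only [Category.assoc, hr]
    rw [← comp_whiskerRight_assoc, hr, whisker_exchange_assoc, right_assoc]
    simp
  middle_assoc := by
    rw [← cancel_mono i]
    simp only [Category.assoc, hr, hl]
    rw [← comp_whiskerRight_assoc, hl, ← whiskerLeft_comp_assoc, hr]
    simp

section

variable [HasEqualizers C]

/-- The first of the two morphisms `hom(V, W) ⟶ hom(V ⊗ A, W)` whose equalizer is
`hom_A(V, W)`. -/
def homA₁ (V W : Bimod A A) : rhom V.X W.X ⟶ rhom (V.X ⊗ A.X) W.X :=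
  ζ (_ ◁ V.actRight ≫ ev V.X W.X)

/-- The second of the two morphisms `hom(V, W) ⟶ hom(V ⊗ A, W)` whose equalizer is
`hom_A(V, W)`. -/
def homA₂ (V W : Bimod A A) : rhom V.X W.X ⟶ rhom (V.X ⊗ A.X) W.X :=
  ζ ((α_ _ _ _).inv ≫ ev V.X W.X ▷ A.X ≫ W.actRight)

theorem homA_iff (V W : Bimod A A) {Y : C} (t : Y ⟶ rhom V.X W.X) :
    t ≫ homA₁ V W = t ≫ homA₂ V W ↔
      Y ◁ V.actRight ≫ t ▷ V.X ≫ ev V.X W.X =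
        (α_ _ _ _).inv ≫ (t ▷ V.X ≫ ev V.X W.X) ▷ A.X ≫ W.actRight := by
  rw [homA₁, homA₂, ← ζ_naturality_left, ← ζ_naturality_left, Equiv.apply_eq_iff_eq,
    ← whisker_exchange_assoc, associator_inv_naturality_left_assoc, comp_whiskerRight,
    Category.assoc]

/-- The object `hom_A(V, W)` of right `A`-linear internal homomorphisms. -/
noncomputable def homAX (V W : Bimod A A) : C := equalizer (homA₁ V W) (homA₂ V W)

/-- The inclusion `hom_A(V, W) ⟶ hom(V, W)`. -/
noncomputable def homAι (V W : Bimod A A) : homAX V W ⟶ rhom V.X W.X :=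
  equalizer.ι (homA₁ V W) (homA₂ V W)

instance (V W : Bimod A A) : Mono (homAι V W) :=
  equalizer.ι_mono

/-- The restricted evaluation `hom_A(V, W) ⊗ V ⟶ W`. -/
noncomputable def homAev (V W : Bimod A A) : homAX V W ⊗ V.X ⟶ W.X :=
  homAι V W ▷ V.X ≫ ev V.X W.X

theorem homAev_right (V W : Bimod A A) : homAX V W ◁ V.actRight ≫ homAev V W =
    (α_ _ _ _).inv ≫ homAev V W ▷ A.X ≫ W.actRight :=
  (homA_iff V W (homAι V W)).1 (equalizer.condition _ _)

/-- The morphism into `hom_A(V, W)` given by a morphism into `hom(V, W)` with right `A`-linear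
adjunct. -/
noncomputable def homAlift (V W : Bimod A A) {Y : C} (t : Y ⟶ rhom V.X W.X)
    (h : Y ◁ V.actRight ≫ t ▷ V.X ≫ ev V.X W.X =
        (α_ _ _ _).inv ≫ (t ▷ V.X ≫ ev V.X W.X) ▷ A.X ≫ W.actRight) : Y ⟶ homAX V W :=
  equalizer.lift t ((homA_iff V W t).2 h)

theorem homAlift_ι (V W : Bimod A A) {Y : C} (t : Y ⟶ rhom V.X W.X) (h) :
    homAlift V W t h ≫ homAι V W = t := equalizer.lift_ι _ _

theorem homAact_left_ev (V W : Bimod A A) :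
    (A.X ◁ homAι V W ≫ homActLeft V W) ▷ V.X ≫ ev V.X W.X =
      (α_ _ _ _).hom ≫ A.X ◁ homAev V W ≫ W.actLeft := by
  rw [comp_whiskerRight, Category.assoc, homActLeft_ev, associator_naturality_middle_assoc,
    ← whiskerLeft_comp_assoc, homAev]

theorem homAact_right_ev (V W : Bimod A A) :
    (homAι V W ▷ A.X ≫ homActRight V W) ▷ V.X ≫ ev V.X W.X =
      (α_ _ _ _).hom ≫ _ ◁ V.actLeft ≫ homAev V W := by
  rw [comp_whiskerRight, Category.assoc, homActRight_ev, associator_naturality_left_assoc,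
    ← whisker_exchange_assoc, homAev]

/-- The left `A`-action on `hom_A(V, W)`, the restriction of the one on `hom(V, W)`. -/
noncomputable def homAactLeft (V W : Bimod A A) : A.X ⊗ homAX V W ⟶ homAX V W :=
  homAlift V W (A.X ◁ homAι V W ≫ homActLeft V W) <| by
    rw [homAact_left_ev, associator_naturality_right_assoc, ← whiskerLeft_comp_assoc,
      homAev_right]
    simp

/-- The right `A`-action on `hom_A(V, W)`, the restriction of the one on `hom(V, W)`. -/
noncomputable def homAactRight (V W : Bimod A A) : homAX V W ⊗ A.X ⟶ homAX V W :=
  homAlift V W (homAι V W ▷ A.X ≫ homActRight V W) <| by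
    rw [homAact_right_ev]
    simp only [comp_whiskerRight, Category.assoc]
    rw [whisker_assoc]
    simp only [Category.assoc]
    rw [← homAev_right]
    simp only [← whiskerLeft_comp_assoc, middle_assoc]
    simp

theorem homAactLeft_ι (V W : Bimod A A) : homAactLeft V W ≫ homAι V W =
    A.X ◁ homAι V W ≫ homActLeft V W := homAlift_ι _ _ _ _

theorem homAactRight_ι (V W : Bimod A A) : homAactRight V W ≫ homAι V W =
    homAι V W ▷ A.X ≫ homActRight V W := homAlift_ι _ _ _ _

/-- The `A`-bimodule `hom_A(V, W)`. -/
noncomputable def homA (V W : Bimod A A) : Bimod A A :=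
  subBimod (V := homBimod V W) (homAι V W) equalizer.ι_mono
    (homAactLeft V W) (homAactRight V W)
    (homAactLeft_ι V W) (homAactRight_ι V W)

/-- The functoriality of `hom_A`, given by restriction of the one of `hom`. -/
noncomputable def homAmapX {V V' W W' : Bimod A A} (f : V' ⟶ V) (g : W ⟶ W') :
    homAX V W ⟶ homAX V' W' :=
  homAlift V' W' (homAι V W ≫ (ihom.obj (Opposite.op V.X)).map g.hom ≫
    (ihom.map f.hom.op).app W'.X) <| by
    have e : (homAι V W ≫ (ihom.obj (Opposite.op V.X)).map g.hom ≫
        (ihom.map f.hom.op).app W'.X) ▷ V'.X ≫ ev V'.X W'.X =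
        homAX V W ◁ f.hom ≫ homAev V W ≫ g.hom := by
      rw [comp_whiskerRight, Category.assoc, ihom_map_ev, ← whisker_exchange_assoc, homAev,
        Category.assoc]
    rw [e, ← whiskerLeft_comp_assoc, Hom.right_act_hom, whiskerLeft_comp, Category.assoc,
      ← Category.assoc (homAX V W ◁ V.actRight), homAev_right]
    simp

theorem homAmapX_ι {V V' W W' : Bimod A A} (f : V' ⟶ V) (g : W ⟶ W') :
    homAmapX f g ≫ homAι V' W' = homAι V W ≫ (ihom.obj (Opposite.op V.X)).map g.hom ≫
    (ihom.map f.hom.op).app W'.X := homAlift_ι _ _ _ _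

theorem homAmapX_ev {V V' W W' : Bimod A A} (f : V' ⟶ V) (g : W ⟶ W') :
    homAmapX f g ▷ V'.X ≫ homAev V' W' = homAX V W ◁ f.hom ≫ homAev V W ≫ g.hom := by
  rw [homAev, ← comp_whiskerRight_assoc, homAmapX_ι, comp_whiskerRight, Category.assoc,
    ihom_map_ev, ← whisker_exchange_assoc, homAev, Category.assoc]

theorem homA_ext {V W : Bimod A A} {Y : C} {s t : Y ⟶ homAX V W}
    (h : s ▷ V.X ≫ homAev V W = t ▷ V.X ≫ homAev V W) : s = t := by
  rw [← cancel_mono (homAι V W)]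
  apply rhom_ext
  simpa [homAev] using h

theorem homAactLeft_ev (V W : Bimod A A) : homAactLeft V W ▷ V.X ≫ homAev V W =
    (α_ _ _ _).hom ≫ A.X ◁ homAev V W ≫ W.actLeft := by
  rw [← homAact_left_ev, ← homAactLeft_ι, comp_whiskerRight, Category.assoc, homAev]

theorem homAactRight_ev (V W : Bimod A A) : homAactRight V W ▷ V.X ≫ homAev V W =
    (α_ _ _ _).hom ≫ _ ◁ V.actLeft ≫ homAev V W := by
  rw [← homAact_right_ev, ← homAactRight_ι, comp_whiskerRight, Category.assoc, homAev]

/-- `hom_A(f, g)`, the restriction of `hom(f, g)`. -/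
noncomputable def homAmap {V V' W W' : Bimod A A} (f : V' ⟶ V) (g : W ⟶ W') :
    homA V W ⟶ homA V' W' where
  hom := homAmapX f g
  left_act_hom := homA_ext <| by
    change (homAactLeft V W ≫ homAmapX f g) ▷ V'.X ≫ homAev V' W' =
      (A.X ◁ homAmapX f g ≫ homAactLeft V' W') ▷ V'.X ≫ homAev V' W'
    simp only [comp_whiskerRight, Category.assoc, homAmapX_ev, homAactLeft_ev]
    rw [← whisker_exchange_assoc, ← Category.assoc (homAactLeft V W ▷ V.X), homAactLeft_ev,
      associator_naturality_middle_assoc, ← whiskerLeft_comp_assoc, homAmapX_ev]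
    simp
  right_act_hom := homA_ext <| by
    change (homAactRight V W ≫ homAmapX f g) ▷ V'.X ≫ homAev V' W' =
      (homAmapX f g ▷ A.X ≫ homAactRight V' W') ▷ V'.X ≫ homAev V' W'
    simp only [comp_whiskerRight, Category.assoc, homAmapX_ev, homAactRight_ev]
    rw [← whisker_exchange_assoc, ← Category.assoc (homAactRight V W ▷ V.X), homAactRight_ev,
      associator_naturality_left_assoc, ← whisker_exchange_assoc, homAmapX_ev]
    simp only [← whiskerLeft_comp_assoc, Hom.left_act_hom]
    simp

theorem homAmap_comp {V V' V'' W W' W'' : Bimod A A} (f : V' ⟶ V) (g : W ⟶ W') (f' : V'' ⟶ V')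
    (g' : W' ⟶ W'') : homAmap f g ≫ homAmap f' g' = homAmap (f' ≫ f) (g ≫ g') := by
  apply Bimod.hom_ext
  refine homA_ext (s := homAmapX f g ≫ homAmapX f' g') (t := homAmapX (f' ≫ f) (g ≫ g')) ?_
  rw [comp_whiskerRight, Category.assoc, homAmapX_ev, homAmapX_ev, ← whisker_exchange_assoc,
    ← Category.assoc (homAmapX f g ▷ V'.X), homAmapX_ev]
  simp

theorem homAmap_id (V W : Bimod A A) : homAmap (𝟙 V) (𝟙 W) = 𝟙 _ := by
  apply Bimod.hom_ext
  refine homA_ext (s := homAmapX (𝟙 V) (𝟙 W)) (t := 𝟙 (homAX V W)) ?_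
  rw [homAmapX_ev]
  simp

/-- The functor `hom_A`. -/
@[simps]
noncomputable def homAFunctor (A : Mon C) : (Bimod A A)ᵒᵖ ⥤ Bimod A A ⥤ Bimod A A where
  obj V :=
    { obj := fun W => homA V.unop W
      map := fun g => homAmap (𝟙 V.unop) g
      map_id := fun W => homAmap_id V.unop W
      map_comp := fun f g => by rw [homAmap_comp, Category.comp_id] }
  map f :=
    { app := fun W => homAmap f.unop (𝟙 W)
      naturality := fun W W' g => by simp [homAmap_comp] }
  map_id V := by
    ext W : 2
    exact homAmap_id V.unop W
  map_comp f g := by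
    ext W : 2
    simp [homAmap_comp]

end

section Tensor

variable [HasCoequalizers C] [∀ X : C, PreservesColimitsOfSize.{0, 0} (tensorLeft X)]
  [∀ X : C, PreservesColimitsOfSize.{0, 0} (tensorRight X)]

/-- The monoidal category of `A`-bimodules, as endomorphisms in a bicategory. -/
@[reducible]
noncomputable def endMonoidal (A : Mon C) : MonoidalCategory (Bimod A A) :=
  @CategoryTheory.instMonoidalCategoryHom (Mon C) monBicategory A

/-- The monoidal category of `A`-bimodules with the tensor product `⊗_A`. -/
noncomputable instance (A : Mon C) : MonoidalCategory (Bimod A A) where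
  tensorObj V W := tensorBimod V W
  whiskerLeft V _ _ f := Bimod.whiskerLeft V f
  whiskerRight f W := Bimod.whiskerRight f W
  tensorUnit := regular A
  associator := associatorBimod
  leftUnitor := leftUnitorBimod
  rightUnitor := rightUnitorBimod
  tensorHom_comp_tensorHom f g f' g' := (endMonoidal A).tensorHom_comp_tensorHom f g f' g'
  id_tensorHom_id V W := (endMonoidal A).id_tensorHom_id V W
  associator_naturality f g h := (endMonoidal A).associator_naturality f g h
  leftUnitor_naturality f := (endMonoidal A).leftUnitor_naturality f
  rightUnitor_naturality f := (endMonoidal A).rightUnitor_naturality f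
  whiskerLeft_id _ _ := whiskerLeft_id_bimod
  id_whiskerRight _ _ := id_whiskerRight_bimod
  pentagon := pentagon_bimod
  triangle := triangle_bimod

/-- The projection `π : V ⊗ W ⟶ V ⊗_A W`. -/
noncomputable def tensorπ {A : Mon C} (V W : Bimod A A) : V.X ⊗ W.X ⟶ (V ⊗ W).X :=
  coequalizer.π (V.actRight ▷ W.X) ((α_ _ _ _).hom ≫ (V.X ◁ W.actLeft))

end Tensor

/-- Symmetric `A`-bimodules: the right action composed with the braiding `A ⊗ V ⟶ V ⊗ A` is the
left action, and the left action composed with the braiding `V ⊗ A ⟶ A ⊗ V` is the right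
action. -/
def symmetric [BraidedCategory C] (A : Mon C) : ObjectProperty (Bimod A A) := fun V =>
  (β_ A.X V.X).hom ≫ V.actRight = V.actLeft ∧ (β_ V.X A.X).hom ≫ V.actLeft = V.actRight

/-- The restriction of `hom_A` to symmetric bimodules. -/
noncomputable def symHomA [HasEqualizers C] [BraidedCategory C] (A : Mon C)
    (h : ∀ V W : Bimod A A, symmetric A V → symmetric A W → symmetric A (homA V W)) :
    (symmetric A).FullSubcategoryᵒᵖ ⥤ (symmetric A).FullSubcategory ⥤
      (symmetric A).FullSubcategory where
  obj V :=
    { obj := fun W => ⟨homA V.unop.obj W.obj, h _ _ V.unop.property W.property⟩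
      map := fun g => ObjectProperty.homMk (homAmap (𝟙 V.unop.obj) g.hom)
      map_id := fun W => by
        apply ObjectProperty.hom_ext
        exact homAmap_id _ _
      map_comp := fun f g => by
        apply ObjectProperty.hom_ext
        simp [homAmap_comp] }
  map f :=
    { app := fun W => ObjectProperty.homMk (homAmap f.unop.hom (𝟙 W.obj))
      naturality := fun W W' g => by
        apply ObjectProperty.hom_ext
        simp [homAmap_comp] }
  map_id V := by
    ext W : 2
    apply ObjectProperty.hom_ext
    exact homAmap_id _ _
  map_comp f g := by
    ext W : 2
    apply ObjectProperty.hom_ext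
    simp [homAmap_comp]

end Bimod

end Generic

/-! The Hopf-theoretic data enter only through properties of the category `C` of `H`-modules: it is
braided monoidal, has equalizers and coequalizers, and each functor `- ⊗ W` has a right adjoint.
Hence `- ⊗ W` preserves colimits, and through the braiding so does `W ⊗ -`. The proof works with a
monoid `A` in any such `C`. Commutativity of `A` serves only to make the unit bimodule symmetric.

Two reductions turn every claim over `A` into one in `C`. The projection `V ⊗ W ⟶ V ⊗_A W` is epi
and stays so after tensoring, so equations out of `V ⊗_A W` are checked on `V ⊗ W`. A morphism into
`hom_A(V, W)` is determined by its composite with the restricted evaluation `homAev`. The actions,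
associator, braiding and transposes over `A` are each characterised by such a composite.

Symmetry lets the left and right actions be exchanged at the price of a crossing with `A`. As the
braiding need not be involutive, both clauses of the definition matter: together they give l = r∘τ
and l = r∘τ⁻¹. A first gain is that a left linear map between symmetric bimodules is automatically
right linear (`symmetric.right_act_hom`), so only left linearity is ever computed.

For `V ⊗_A W`, the hexagon carries `A` past one factor at a time; on each factor one action becomes
the other, and between the factors `A` slides across `⊗_A`. The same mechanism gives
`actLeft_braiding_tensorπ`: the map π∘τ is left `A`-linear as soon as `W` is symmetric. This yields
both that π∘τ is balanced, so that τ descends, and that the descended map is linear. The inverse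
braiding descends by the opposite clauses of symmetry, which makes the descended map invertible;
naturality and the hexagons are inherited from `C`.

For `hom_A(V, W)` the actions are (aL)(v) = aL(v) and (La)(v) = L(av), while the equalizer imposes
L(va) = L(v)a. Up to braidings, aL(v) = L(v)a = L(va) = L(av), so the two actions agree.

For the adjunction, transpose f∘π by ζ. Right linearity of f says that the transpose lands in
`hom_A(W, X)`; left linearity of f is left linearity of the transpose; balancedness of f∘π is right
linearity of the transpose. Thus ζ restricts to the required bijection, and naturality is again
tested by evaluation. -/

namespace Bimod

open MonObj RightClosed

/-! ### The tensor product over `A`, described through its projection. -/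

section TensorProj

variable {C : Type*} [Category* C] [MonoidalCategory C] [HasCoequalizers C]
  [∀ X : C, PreservesColimitsOfSize.{0, 0} (tensorLeft X)]
  [∀ X : C, PreservesColimitsOfSize.{0, 0} (tensorRight X)] {A : Mon C}

instance (V W : Bimod A A) : Epi (tensorπ V W) := coequalizer.π_epi

/-- Tensoring preserves colimits, hence epimorphisms. This allows linearity and associativity to be
tested before passing to the quotient, with a further tensor factor present. -/
instance (V W : Bimod A A) (Y : C) : Epi (Y ◁ tensorπ V W) :=
  inferInstanceAs (Epi ((tensorLeft Y).map (coequalizer.π _ _)))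

instance (V W : Bimod A A) (Y : C) : Epi (tensorπ V W ▷ Y) :=
  inferInstanceAs (Epi ((tensorRight Y).map (coequalizer.π _ _)))

theorem tensorπ_condition (V W : Bimod A A) :
    V.actRight ▷ W.X ≫ tensorπ V W = (α_ _ _ _).hom ≫ V.X ◁ W.actLeft ≫ tensorπ V W :=
  (coequalizer.condition _ _).trans (Category.assoc _ _ _)

theorem whiskerLeft_actLeft_tensorπ (V W : Bimod A A) :
    V.X ◁ W.actLeft ≫ tensorπ V W = (α_ _ _ _).inv ≫ V.actRight ▷ W.X ≫ tensorπ V W := by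
  simp [tensorπ_condition]

/-- The morphism out of `V ⊗_A W` given by an `A`-balanced morphism out of `V ⊗ W`. -/
noncomputable def tensorDesc {V W : Bimod A A} {Y : C} (f : V.X ⊗ W.X ⟶ Y)
    (h : V.actRight ▷ W.X ≫ f = (α_ _ _ _).hom ≫ V.X ◁ W.actLeft ≫ f) : (V ⊗ W).X ⟶ Y :=
  coequalizer.desc f (by simpa using h)

theorem tensorπ_desc {V W : Bimod A A} {Y : C} (f : V.X ⊗ W.X ⟶ Y)
    (h : V.actRight ▷ W.X ≫ f = (α_ _ _ _).hom ≫ V.X ◁ W.actLeft ≫ f) :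
    tensorπ V W ≫ tensorDesc f h = f := coequalizer.π_desc _ _

theorem tensorπ_actLeft (V W : Bimod A A) :
    A.X ◁ tensorπ V W ≫ (V ⊗ W).actLeft =
      (α_ _ _ _).inv ≫ V.actLeft ▷ W.X ≫ tensorπ V W :=
  TensorBimod.whiskerLeft_π_actLeft V W

theorem tensorπ_actRight (V W : Bimod A A) :
    tensorπ V W ▷ A.X ≫ (V ⊗ W).actRight =
      (α_ _ _ _).hom ≫ V.X ◁ W.actRight ≫ tensorπ V W :=
  TensorBimod.π_tensor_id_actRight V W

theorem tensorπ_whiskerLeft (V : Bimod A A) {W W' : Bimod A A} (f : W ⟶ W') :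
    tensorπ V W ≫ (V ◁ f).hom = V.X ◁ f.hom ≫ tensorπ V W' :=
  ι_colimMap _ _

theorem tensorπ_whiskerRight {V V' : Bimod A A} (f : V ⟶ V') (W : Bimod A A) :
    tensorπ V W ≫ (f ▷ W).hom = f.hom ▷ W.X ≫ tensorπ V' W :=
  ι_colimMap _ _

/-- Since `- ⊗ W` preserves the coequalizer defining `U ⊗_A V`, a map out of `(U ⊗_A V) ⊗ W` is
induced from `(U ⊗ V) ⊗ W`. The associator over `A` is built in this way and then descends along the
outer projection, so it lies over the associator of `C`. -/
theorem tensorπ_associator_hom (U V W : Bimod A A) :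
    tensorπ U V ▷ W.X ≫ tensorπ (U ⊗ V) W ≫ (α_ U V W).hom.hom =
      (α_ _ _ _).hom ≫ U.X ◁ tensorπ V W ≫ tensorπ U (V ⊗ W) := by
  have h : tensorπ (U ⊗ V) W ≫ (α_ U V W).hom.hom = AssociatorBimod.homAux U V W :=
    coequalizer.π_desc _ _
  rw [h]
  exact π_tensor_id_preserves_coequalizer_inv_desc _ _ _ _

theorem tensorπ_associator_inv (U V W : Bimod A A) :
    U.X ◁ tensorπ V W ≫ tensorπ U (V ⊗ W) ≫ (α_ U V W).inv.hom =
      (α_ _ _ _).inv ≫ tensorπ U V ▷ W.X ≫ tensorπ (U ⊗ V) W := by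
  have h : (α_ U V W).hom.hom ≫ (α_ U V W).inv.hom = 𝟙 _ :=
    congrArg Hom.hom (α_ U V W).hom_inv_id
  have e := (reassoc_of% tensorπ_associator_hom U V W) (α_ U V W).inv.hom
  rw [h, Category.comp_id] at e
  rw [e, Iso.inv_hom_id_assoc]

theorem tensor_ext {V W : Bimod A A} {Y : C} {f g : (V ⊗ W).X ⟶ Y}
    (h : tensorπ V W ≫ f = tensorπ V W ≫ g) : f = g :=
  (cancel_epi _).1 h

end TensorProj

/-! ### Symmetric bimodules and the exchange of left and right actions. -/

section Symmetric

variable {C : Type*} [Category* C] [MonoidalCategory C] [BraidedCategory C] {A : Mon C}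

namespace symmetric

variable {V W : Bimod A A}

/-- The second clause of symmetry, solved for the left action. Beside the first clause it shows that
`A` may cross `V` either over or under; this is what arguments with the inverse braiding need, since
the braiding is not involutive in general. -/
theorem braiding_inv_actRight (hV : symmetric A V) :
    (β_ V.X A.X).inv ≫ V.actRight = V.actLeft := by
  rw [Iso.inv_comp_eq, hV.2]

theorem braiding_inv_actLeft (hV : symmetric A V) :
    (β_ A.X V.X).inv ≫ V.actLeft = V.actRight := by
  rw [Iso.inv_comp_eq, hV.1]

/-- A left `A`-linear morphism between symmetric bimodules is right `A`-linear. -/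
theorem right_act_hom (hV : symmetric A V) (hW : symmetric A W) {f : V.X ⟶ W.X}
    (h : V.actLeft ≫ f = A.X ◁ f ≫ W.actLeft) : V.actRight ≫ f = f ▷ A.X ≫ W.actRight := by
  -- Both right actions are left actions preceded by a crossing, and naturality of the braiding
  -- moves `f` through the crossing.
  rw [← hV.2, ← hW.2, Category.assoc, h, BraidedCategory.braiding_naturality_left_assoc]

/-- A left `A`-linear morphism between symmetric bimodules as a morphism of bimodules. -/
def homMk (hV : symmetric A V) (hW : symmetric A W) (f : V.X ⟶ W.X)
    (h : V.actLeft ≫ f = A.X ◁ f ≫ W.actLeft) : V ⟶ W where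
  hom := f
  left_act_hom := h
  right_act_hom := hV.right_act_hom hW h

end symmetric

/-- Both actions on the regular bimodule are the product of `A`, so each clause is braided
commutativity. -/
theorem symmetric_regular [IsCommMonObj A.X] : symmetric A (regular A) :=
  ⟨IsCommMonObj.mul_comm A.X, IsCommMonObj.mul_comm A.X⟩

/-! ### Symmetry of `V ⊗_A W` and descent of the braiding. -/

section Tensor

variable [HasCoequalizers C] [∀ X : C, PreservesColimitsOfSize.{0, 0} (tensorLeft X)]
  [∀ X : C, PreservesColimitsOfSize.{0, 0} (tensorRight X)] {V W X : Bimod A A}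

/-- The hexagon splits the crossing of `A` with `V ⊗ W` into one crossing with each factor. In the
first clause the right action on `W` absorbs its crossing and becomes the left action on `W`;
balancing over `A` turns this into the right action on `V`, which absorbs the other crossing and
becomes the left action on `V`. The second clause runs through the same chain from the other end. -/
theorem symmetric.tensor (hV : symmetric A V) (hW : symmetric A W) : symmetric A (V ⊗ W) := by
  constructor
  · rw [← cancel_epi (A.X ◁ tensorπ V W), BraidedCategory.braiding_naturality_right_assoc,
      tensorπ_actRight, tensorπ_actLeft, BraidedCategory.braiding_tensor_right_hom]
    simp only [Category.assoc, Iso.inv_hom_id_assoc]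
    rw [← whiskerLeft_comp_assoc, hW.1, ← tensorπ_condition, ← comp_whiskerRight_assoc, hV.1]
  · rw [← cancel_epi (tensorπ V W ▷ A.X), BraidedCategory.braiding_naturality_left_assoc,
      tensorπ_actRight, tensorπ_actLeft, BraidedCategory.braiding_tensor_left_hom]
    simp only [Category.assoc, Iso.hom_inv_id_assoc]
    rw [← comp_whiskerRight_assoc, hV.2, ← whiskerLeft_actLeft_tensorπ, ← whiskerLeft_comp_assoc,
      hW.2]

/-- Left linearity of the braiding followed by the projection. By naturality `A` and `V` cross `W`
together and `A` then acts on `V`; balancing makes it act on `W` from the right, and symmetry of `W`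
absorbs the crossing of `A` with `W`. No symmetry of `V` is needed. Both the descent of the braiding
and the linearity of the descended map rest on this. -/
theorem actLeft_braiding_tensorπ (V : Bimod A A) (hW : symmetric A W) :
    V.actLeft ▷ W.X ≫ (β_ V.X W.X).hom ≫ tensorπ W V =
      (α_ _ _ _).hom ≫ A.X ◁ (β_ V.X W.X).hom ≫ (α_ _ _ _).inv ≫ W.actLeft ▷ V.X ≫
        tensorπ W V := by
  rw [BraidedCategory.braiding_naturality_left_assoc, whiskerLeft_actLeft_tensorπ,
    BraidedCategory.braiding_tensor_left_hom]
  simp only [Category.assoc, Iso.hom_inv_id_assoc]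
  rw [← comp_whiskerRight_assoc, hW.1]

/-- The same argument with all crossings reversed; the crossing of `A` with `W` is now absorbed by
the other clause of symmetry. -/
theorem actLeft_braiding_inv_tensorπ (V : Bimod A A) (hW : symmetric A W) :
    V.actLeft ▷ W.X ≫ (β_ W.X V.X).inv ≫ tensorπ W V =
      (α_ _ _ _).hom ≫ A.X ◁ (β_ W.X V.X).inv ≫ (α_ _ _ _).inv ≫ W.actLeft ▷ V.X ≫
        tensorπ W V := by
  rw [BraidedCategory.braiding_inv_naturality_left_assoc, whiskerLeft_actLeft_tensorπ,
    BraidedCategory.braiding_tensor_right_inv]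
  simp only [Category.assoc, Iso.hom_inv_id_assoc]
  rw [← comp_whiskerRight_assoc, hW.braiding_inv_actRight]

/-- Replacing the right action on `V` by a crossing and the left action makes
`actLeft_braiding_tensorπ` applicable. On the other side, naturality and the hexagon for `V` past `A
⊗ W` produce the same crossing of `V` with `A`, then that of `V` with `W`, then the left action on
`W`. -/
theorem braiding_balanced (hV : symmetric A V) (hW : symmetric A W) :
    V.actRight ▷ W.X ≫ (β_ V.X W.X).hom ≫ tensorπ W V =
      (α_ _ _ _).hom ≫ V.X ◁ W.actLeft ≫ (β_ V.X W.X).hom ≫ tensorπ W V := by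
  rw [← hV.2, comp_whiskerRight_assoc, actLeft_braiding_tensorπ V hW,
    BraidedCategory.braiding_naturality_right_assoc, BraidedCategory.braiding_tensor_right_hom]
  simp

theorem braiding_inv_balanced (hV : symmetric A V) (hW : symmetric A W) :
    V.actRight ▷ W.X ≫ (β_ W.X V.X).inv ≫ tensorπ W V =
      (α_ _ _ _).hom ≫ V.X ◁ W.actLeft ≫ (β_ W.X V.X).inv ≫ tensorπ W V := by
  rw [← hV.braiding_inv_actLeft, comp_whiskerRight_assoc, actLeft_braiding_inv_tensorπ V hW,
    BraidedCategory.braiding_inv_naturality_right_assoc,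
    BraidedCategory.braiding_tensor_left_inv]
  simp

/-! ### The braiding over `A`: invertibility, linearity, naturality, hexagons. -/

/-- The morphism `V ⊗_A W ⟶ W ⊗_A V` underlying the braiding of symmetric bimodules. -/
noncomputable def tensorBraidingX (hV : symmetric A V) (hW : symmetric A W) :
    (V ⊗ W).X ≅ (W ⊗ V).X where
  hom := tensorDesc _ (braiding_balanced hV hW)
  -- The inverse comes from the inverse braiding of `V` and `W`, not from the braiding of `W` with
  -- `V`: the two differ unless the braiding is involutive.
  inv := tensorDesc _ (braiding_inv_balanced hW hV)
  hom_inv_id := tensor_ext (by simp [tensorπ_desc, reassoc_of% tensorπ_desc])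
  inv_hom_id := tensor_ext (by simp [tensorπ_desc, reassoc_of% tensorπ_desc])

theorem tensorπ_tensorBraidingX (hV : symmetric A V) (hW : symmetric A W) :
    tensorπ V W ≫ (tensorBraidingX hV hW).hom = (β_ V.X W.X).hom ≫ tensorπ W V :=
  tensorπ_desc _ (braiding_balanced hV hW)

theorem actLeft_tensorBraidingX (hV : symmetric A V) (hW : symmetric A W) :
    (V ⊗ W).actLeft ≫ (tensorBraidingX hV hW).hom =
      A.X ◁ (tensorBraidingX hV hW).hom ≫ (W ⊗ V).actLeft := by
  rw [← cancel_epi (A.X ◁ tensorπ V W), reassoc_of% tensorπ_actLeft, tensorπ_tensorBraidingX,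
    actLeft_braiding_tensorπ V hW, ← whiskerLeft_comp_assoc, tensorπ_tensorBraidingX,
    whiskerLeft_comp_assoc, tensorπ_actLeft]
  simp

/-- The braiding `V ⊗_A W ≅ W ⊗_A V` of symmetric bimodules. -/
noncomputable def tensorBraiding (hV : symmetric A V) (hW : symmetric A W) : V ⊗ W ≅ W ⊗ V :=
  isoOfIso (tensorBraidingX hV hW) (actLeft_tensorBraidingX hV hW)
    -- Right linearity comes for free, since source and target are symmetric by `symmetric.tensor`.
    ((hV.tensor hW).right_act_hom (hW.tensor hV) (actLeft_tensorBraidingX hV hW))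

theorem tensorπ_tensorBraiding (hV : symmetric A V) (hW : symmetric A W) :
    tensorπ V W ≫ (tensorBraiding hV hW).hom.hom = (β_ V.X W.X).hom ≫ tensorπ W V :=
  tensorπ_tensorBraidingX hV hW

theorem tensorBraiding_naturality_right {W' : Bimod A A} (hV : symmetric A V)
    (hW : symmetric A W) (hW' : symmetric A W') (f : W ⟶ W') :
    V ◁ f ≫ (tensorBraiding hV hW').hom = (tensorBraiding hV hW).hom ≫ f ▷ V := by
  apply Bimod.hom_ext
  refine tensor_ext ?_
  rw [comp_hom', comp_hom', reassoc_of% tensorπ_whiskerLeft, tensorπ_tensorBraiding,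
    reassoc_of% tensorπ_tensorBraiding, tensorπ_whiskerRight,
    BraidedCategory.braiding_naturality_right_assoc]

theorem tensorBraiding_naturality_left {V' : Bimod A A} (hV : symmetric A V)
    (hV' : symmetric A V') (hW : symmetric A W) (f : V ⟶ V') :
    f ▷ W ≫ (tensorBraiding hV' hW).hom = (tensorBraiding hV hW).hom ≫ W ◁ f := by
  apply Bimod.hom_ext
  refine tensor_ext ?_
  rw [comp_hom', comp_hom', reassoc_of% tensorπ_whiskerRight, tensorπ_tensorBraiding,
    reassoc_of% tensorπ_tensorBraiding, tensorπ_whiskerLeft,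
    BraidedCategory.braiding_naturality_left_assoc]

theorem tensorBraiding_hexagon_forward (hV : symmetric A V) (hW : symmetric A W)
    (hX : symmetric A X) :
    (α_ V W X).hom ≫ (tensorBraiding hV (hW.tensor hX)).hom ≫ (α_ W X V).hom =
      (tensorBraiding hV hW).hom ▷ X ≫ (α_ W V X).hom ≫ W ◁ (tensorBraiding hV hX).hom := by
  apply Bimod.hom_ext
  refine tensor_ext ?_
  -- Together with the projection already cancelled, this tests the equation on `(V ⊗ W) ⊗ X`.
  -- Pushing the projections to the end replaces each arrow over `A` by its counterpart in `C`,
  -- leaving the hexagon of `C`.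
  rw [← cancel_epi (tensorπ V W ▷ X.X)]
  simp only [comp_hom']
  rw [reassoc_of% tensorπ_associator_hom, reassoc_of% tensorπ_tensorBraiding,
    BraidedCategory.braiding_naturality_right_assoc, tensorπ_associator_hom,
    reassoc_of% tensorπ_whiskerRight, ← comp_whiskerRight_assoc, tensorπ_tensorBraiding,
    comp_whiskerRight_assoc, reassoc_of% tensorπ_associator_hom, tensorπ_whiskerLeft,
    ← whiskerLeft_comp_assoc, tensorπ_tensorBraiding, whiskerLeft_comp_assoc,
    BraidedCategory.hexagon_forward_assoc]

theorem tensorBraiding_hexagon_reverse (hV : symmetric A V) (hW : symmetric A W)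
    (hX : symmetric A X) :
    (α_ V W X).inv ≫ (tensorBraiding (hV.tensor hW) hX).hom ≫ (α_ X V W).inv =
      V ◁ (tensorBraiding hW hX).hom ≫ (α_ V X W).inv ≫ (tensorBraiding hV hX).hom ▷ W := by
  apply Bimod.hom_ext
  refine tensor_ext ?_
  -- Here the source is bracketed to the right, so the test object is `V ⊗ (W ⊗ X)`.
  rw [← cancel_epi (V.X ◁ tensorπ W X)]
  simp only [comp_hom']
  rw [reassoc_of% tensorπ_associator_inv, reassoc_of% tensorπ_tensorBraiding,
    BraidedCategory.braiding_naturality_left_assoc, tensorπ_associator_inv,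
    reassoc_of% tensorπ_whiskerLeft, ← whiskerLeft_comp_assoc, tensorπ_tensorBraiding,
    whiskerLeft_comp_assoc, reassoc_of% tensorπ_associator_inv, tensorπ_whiskerRight,
    ← comp_whiskerRight_assoc, tensorπ_tensorBraiding, comp_whiskerRight_assoc,
    BraidedCategory.hexagon_reverse_assoc]

instance symmetric_isMonoidal [IsCommMonObj A.X] : (symmetric A).IsMonoidal where
  prop_unit := symmetric_regular
  prop_tensor _ _ hV hW := hV.tensor hW

/-- The braided monoidal category of symmetric `A`-bimodules. -/
@[reducible]
noncomputable def symmetricBraided [IsCommMonObj A.X] :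
    BraidedCategory (symmetric A).FullSubcategory where
  braiding V W := (symmetric A).isoMk (tensorBraiding V.property W.property)
  braiding_naturality_right _ _ _ f := ObjectProperty.hom_ext _
    (tensorBraiding_naturality_right _ _ _ f.hom)
  braiding_naturality_left f _ := ObjectProperty.hom_ext _
    (tensorBraiding_naturality_left _ _ _ f.hom)
  hexagon_forward U V W := ObjectProperty.hom_ext _
    (tensorBraiding_hexagon_forward U.property V.property W.property)
  hexagon_reverse U V W := ObjectProperty.hom_ext _
    (tensorBraiding_hexagon_reverse U.property V.property W.property)

end Tensor

/-! ### Symmetry of the internal hom. -/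

section InternalHom

variable [RightClosed C] [HasEqualizers C] {V W X : Bimod A A}

/-- After evaluation the left action multiplies the value in `W`, while the right action multiplies
the argument in `V`. Symmetry of `W` makes the former a right multiplication of the value, right
linearity moves it onto the argument, and symmetry of `V` makes it a left multiplication there. The
hexagon for `A` and `hom_A(V, W) ⊗ V` accounts for the crossings. -/
theorem symmetric.homA (hV : symmetric A V) (hW : symmetric A W) :
    symmetric A (homA V W) := by
  constructor
  · refine homA_ext (V := V) (W := W) (s := (β_ A.X (homAX V W)).hom ≫ homAactRight V W)
      (t := homAactLeft V W) ?_
    rw [homAactLeft_ev, comp_whiskerRight_assoc, homAactRight_ev, ← hW.1,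
      BraidedCategory.braiding_naturality_right_assoc, BraidedCategory.braiding_tensor_right_hom,
      ← hV.1]
    simp only [Category.assoc, Iso.hom_inv_id_assoc, whiskerLeft_comp]
    -- The equalizer condition, L(va) = L(v)a, is what remains once the crossings agree.
    rw [homAev_right]
  · refine homA_ext (V := V) (W := W) (s := (β_ (homAX V W) A.X).hom ≫ homAactLeft V W)
      (t := homAactRight V W) ?_
    -- The left action on `V` is written with the inverse crossing, which cancels the crossing of
    -- `V` with `A` that the hexagon produces; only that of `hom_A(V, W)` with `A` survives.
    rw [comp_whiskerRight_assoc, homAactLeft_ev, homAactRight_ev, ← hV.braiding_inv_actRight,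
      whiskerLeft_comp_assoc, homAev_right, ← hW.2,
      BraidedCategory.braiding_naturality_left_assoc, BraidedCategory.braiding_tensor_left_hom]
    simp

end InternalHom

/-! ### Currying and uncurrying over `A`. -/

section Closed

variable [RightClosed C] [HasEqualizers C] [HasCoequalizers C]
  [∀ X : C, PreservesColimitsOfSize.{0, 0} (tensorLeft X)]
  [∀ X : C, PreservesColimitsOfSize.{0, 0} (tensorRight X)] {V W X : Bimod A A}

/-- The morphism `V ⟶ hom_A(W, X)` underlying the adjunct of a morphism `V ⊗_A W ⟶ X`. -/
noncomputable def curryX (f : V ⊗ W ⟶ X) : V.X ⟶ homAX W X :=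
  homAlift W X (ζ (tensorπ V W ≫ f.hom)) <| by
    -- The transpose lands in `hom_A(W, X)` because `f` is right linear: the right action on `V ⊗_A
    -- W` is induced by the one on `W`.
    rw [ζ_ev, comp_whiskerRight_assoc, ← f.right_act_hom, reassoc_of% tensorπ_actRight,
      Iso.inv_hom_id_assoc]

theorem curryX_ι (f : V ⊗ W ⟶ X) : curryX f ≫ homAι W X = ζ (tensorπ V W ≫ f.hom) :=
  homAlift_ι _ _ _ _

theorem curryX_ev (f : V ⊗ W ⟶ X) : curryX f ▷ W.X ≫ homAev W X = tensorπ V W ≫ f.hom := by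
  rw [homAev, ← comp_whiskerRight_assoc, curryX_ι, ζ_ev]

/-- The adjunct `V ⟶ hom_A(W, X)` of a morphism `V ⊗_A W ⟶ X`. -/
noncomputable def curryA (hV : symmetric A V) (hW : symmetric A W) (hX : symmetric A X)
    (f : V ⊗ W ⟶ X) : V ⟶ homA W X :=
  hV.homMk (hW.homA hX) (curryX f) <| by
    -- After evaluation this is left linearity of `f`, the left action on `V ⊗_A W` being induced by
    -- the one on `V`. Right linearity of the transpose then follows from symmetry of `V` and
    -- `hom_A(W, X)`.
    refine homA_ext (s := V.actLeft ≫ curryX f) (t := A.X ◁ curryX f ≫ homAactLeft W X) ?_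
    rw [comp_whiskerRight_assoc, curryX_ev, comp_whiskerRight_assoc, homAactLeft_ev,
      associator_naturality_middle_assoc, ← whiskerLeft_comp_assoc, curryX_ev,
      whiskerLeft_comp_assoc, ← f.left_act_hom, reassoc_of% tensorπ_actLeft, Iso.hom_inv_id_assoc]

/-- The morphism `V ⊗_A W ⟶ X` underlying the adjunct of a morphism `V ⟶ hom_A(W, X)`. -/
noncomputable def uncurryX (g : V ⟶ homA W X) : (V ⊗ W).X ⟶ X.X :=
  tensorDesc (Y := X.X) ((show V.X ⟶ homAX W X from g.hom) ▷ W.X ≫ homAev W X) <| by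
    -- Right linearity, g(va) = g(v)a, combined with (La)(w) = L(aw) is exactly the balancing
    -- condition needed to descend to `V ⊗_A W`.
    have h : V.actRight ≫ (show V.X ⟶ homAX W X from g.hom) =
      (show V.X ⟶ homAX W X from g.hom) ▷ A.X ≫ homAactRight W X := g.right_act_hom
    rw [← comp_whiskerRight_assoc, h, comp_whiskerRight_assoc, homAactRight_ev,
      associator_naturality_left_assoc, whisker_exchange_assoc]

theorem tensorπ_uncurryX (g : V ⟶ homA W X) :
    tensorπ V W ≫ uncurryX g = (show V.X ⟶ homAX W X from g.hom) ▷ W.X ≫ homAev W X :=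
  tensorπ_desc _ _

/-- The morphism `V ⊗_A W ⟶ X` with adjunct `V ⟶ hom_A(W, X)`. -/
noncomputable def uncurryA (hV : symmetric A V) (hW : symmetric A W) (hX : symmetric A X)
    (g : V ⟶ homA W X) : V ⊗ W ⟶ X :=
  (hV.tensor hW).homMk hX (uncurryX g) <| by
    have h : V.actLeft ≫ (show V.X ⟶ homAX W X from g.hom) =
      A.X ◁ (show V.X ⟶ homAX W X from g.hom) ≫ homAactLeft W X := g.left_act_hom
    -- On `A ⊗ (V ⊗ W)` the claim is left linearity of `g` seen through evaluation, where `A` acts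
    -- on `hom_A(W, X)` by acting on values.
    rw [← cancel_epi (A.X ◁ tensorπ V W), reassoc_of% tensorπ_actLeft, tensorπ_uncurryX,
      ← comp_whiskerRight_assoc, h, comp_whiskerRight_assoc, homAactLeft_ev,
      associator_naturality_middle_assoc, Iso.inv_hom_id_assoc, ← whiskerLeft_comp_assoc,
      ← whiskerLeft_comp_assoc, tensorπ_uncurryX]

/-- The bijection `Hom(V ⊗_A W, X) ≃ Hom(V, hom_A(W, X))` for symmetric bimodules. -/
noncomputable def curryEquiv (hV : symmetric A V) (hW : symmetric A W) (hX : symmetric A X) :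
    (V ⊗ W ⟶ X) ≃ (V ⟶ homA W X) where
  toFun := curryA hV hW hX
  invFun := uncurryA hV hW hX
  -- `curryX_ev` and `tensorπ_uncurryX` are one and the same relation between a map and its
  -- transpose. Each side determines the other, as the projection is epi and evaluation separates
  -- maps into `hom_A(W, X)`.
  left_inv f := Bimod.hom_ext _ _ <| tensor_ext <|
    (tensorπ_uncurryX (curryA hV hW hX f)).trans (curryX_ev f)
  right_inv g := Bimod.hom_ext _ _ <| homA_ext <|
    (curryX_ev (uncurryA hV hW hX g)).trans (tensorπ_uncurryX g)

/-! ### Naturality in the three variables and the resulting adjunction. -/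

theorem curryX_naturality_left {V' : Bimod A A} (f : V' ⟶ V) (g : V ⊗ W ⟶ X) :
    curryX (f ▷ W ≫ g) = f.hom ≫ curryX g :=
  homA_ext <| by
    rw [curryX_ev, comp_hom', reassoc_of% tensorπ_whiskerRight, comp_whiskerRight_assoc, curryX_ev]

/-- This is the compatibility that joins the adjunctions for the separate `W` into a single one with
parameter `W`. -/
theorem curryX_naturality_mid {W' : Bimod A A} (f : W' ⟶ W) (g : V ⊗ W ⟶ X) :
    curryX (V ◁ f ≫ g) = curryX g ≫ homAmapX f (𝟙 X) :=
  homA_ext <| by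
    rw [curryX_ev, comp_hom', reassoc_of% tensorπ_whiskerLeft, comp_whiskerRight_assoc, homAmapX_ev,
      ← whisker_exchange_assoc, id_hom', Category.comp_id, curryX_ev]

theorem curryX_naturality_right {X' : Bimod A A} (f : V ⊗ W ⟶ X) (g : X ⟶ X') :
    curryX (f ≫ g) = curryX f ≫ homAmapX (𝟙 W) g :=
  homA_ext <| by
    rw [curryX_ev, comp_hom', comp_whiskerRight_assoc, homAmapX_ev, id_hom', whiskerLeft_id,
      Category.id_comp, reassoc_of% curryX_ev]

/-- The bijection `Hom(V ⊗_A W, X) ≃ Hom(V, hom_A(W, X))` in the category of symmetric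
bimodules. -/
noncomputable def symmetricHomEquiv [IsCommMonObj A.X]
    (h : ∀ V W : Bimod A A, symmetric A V → symmetric A W → symmetric A (Bimod.homA V W))
    (V W X : (symmetric A).FullSubcategory) :
    (V ⊗ W ⟶ X) ≃ (V ⟶ ((symHomA A h).obj (Opposite.op W)).obj X) where
  toFun f := ObjectProperty.homMk (curryA V.property W.property X.property f.hom)
  invFun g := ObjectProperty.homMk (uncurryA V.property W.property X.property g.hom)
  left_inv f := ObjectProperty.hom_ext _ <|
    (curryEquiv V.property W.property X.property).left_inv f.hom
  right_inv g := ObjectProperty.hom_ext _ <|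
    (curryEquiv V.property W.property X.property).right_inv g.hom

/-- The tensor product and `hom_A` form an adjunction of symmetric bimodules. -/
noncomputable def symmetricAdj [IsCommMonObj A.X]
    (h : ∀ V W : Bimod A A, symmetric A V → symmetric A W → symmetric A (Bimod.homA V W)) :
    (curriedTensor (symmetric A).FullSubcategory).flip ⊣₂ symHomA A h :=
  ParametrizedAdjunction.mk'
    (fun W => Adjunction.mkOfHomEquiv
      { homEquiv := fun V X => symmetricHomEquiv h V W X
        homEquiv_naturality_left_symm := fun {V' V X} f g => by
          -- Naturality is required of the inverse bijection. Writing the given morphism as a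
          -- transpose reduces it to naturality of currying in `V`.
          obtain ⟨g, rfl⟩ := (symmetricHomEquiv h V W X).surjective g
          rw [Equiv.symm_apply_eq, Equiv.symm_apply_apply]
          exact (ObjectProperty.hom_ext _ <|
            Bimod.hom_ext _ _ <| curryX_naturality_left f.hom g.hom).symm
        homEquiv_naturality_right := fun {V X X'} f g => ObjectProperty.hom_ext _ <|
          Bimod.hom_ext _ _ (curryX_naturality_right (W := W.obj) f.hom g.hom) })
    fun {W W'} f {V X} g => by
      rw [Adjunction.mkOfHomEquiv_homEquiv, Adjunction.mkOfHomEquiv_homEquiv]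
      exact ObjectProperty.hom_ext _ <|
        Bimod.hom_ext _ _ (curryX_naturality_mid (X := X.obj) f.hom g.hom)

/-- Identifies the bijection of the abstract adjunction with the explicit one, so that the
description by ζ can be read off. -/
theorem symmetricAdj_homEquiv [IsCommMonObj A.X]
    (h : ∀ V W : Bimod A A, symmetric A V → symmetric A W → symmetric A (Bimod.homA V W))
    (V W X : (symmetric A).FullSubcategory) :
    (symmetricAdj h).homEquiv (X₁ := W) (X₂ := V) (X₃ := X) = symmetricHomEquiv h V W X := by
  rw [ParametrizedAdjunction.homEquiv_eq]
  exact congrFun (congrFun (Adjunction.mkOfHomEquiv_homEquiv _) V) X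

end Closed

end Symmetric

end Bimod

/-! ### Specialisation to modules over a quasitriangular quasi-Hopf algebra. -/

theorem mainTheorem3 {k : Type u} [CommRing k] {H : Type v} [Ring H] [Algebra k H]
    [QuasitriangularQuasiHopfAlgebra k H] (A : Mon (HModule k H)) [IsCommMonObj A.X] :
    ∃ (_ : (Bimod.symmetric A).IsMonoidal)
      (hhom : ∀ V W : Bimod A A, Bimod.symmetric A V → Bimod.symmetric A W →
        Bimod.symmetric A (Bimod.homA V W)),
      (∃ B : BraidedCategory (Bimod.symmetric A).FullSubcategory,
        ∀ V W : (Bimod.symmetric A).FullSubcategory,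
          Bimod.tensorπ V.obj W.obj ≫ (B.braiding V W).hom.hom.hom =
            (β_ V.obj.X W.obj.X).hom ≫ Bimod.tensorπ W.obj V.obj) ∧
      (∃ adj : (curriedTensor (Bimod.symmetric A).FullSubcategory).flip ⊣₂ Bimod.symHomA A hhom,
        ∀ (V W X : (Bimod.symmetric A).FullSubcategory) (f : V ⊗ W ⟶ X),
          (adj.homEquiv (X₁ := W) (X₂ := V) (X₃ := X) f).hom.hom ≫ Bimod.homAι W.obj X.obj =
            RightClosed.ζ (Bimod.tensorπ V.obj W.obj ≫ f.hom.hom)) :=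
  -- The general results apply because `HModule k H` is braided and right closed and has equalizers
  -- and coequalizers; preservation of colimits by tensoring on either side follows from closedness
  -- and the braiding. The last component is `curryX_ι`, the factorisation of ζ(f∘π) through
  -- `hom_A`.
  ⟨Bimod.symmetric_isMonoidal, fun _ _ hV hW => hV.homA hW,
    ⟨Bimod.symmetricBraided, fun V W => Bimod.tensorπ_tensorBraiding V.property W.property⟩,
    Bimod.symmetricAdj _, fun V W X f => by
      rw [Bimod.symmetricAdj_homEquiv]
      exact Bimod.curryX_ι f.hom⟩
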